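/- All Banach spaces are real. Let $E$ be a Banach space with a normalized Schauder basis $(e_j)_{j\ge1}$, biorthogonal functionals $(e_j^*)_{j\ge 1}$ and basis constant $\lambda=\sup_n\|P_n\|$, where $P_nx=\sum_{j\le n}\langle e_j^*,x\rangle e_j$. Let $C_r,C\ge 1$. **Definitions.** For a Banach space $Z$ let $\mathcal B(Z)$ be the algebra of bounded linear operators on $Z$. For $S,T\in\mathcal B(Z)$ we say that $S$ *factors through $T$ with constant $K^+$* if for every $\gamma>0$ there are $A,B\in\mathcal B(Z)$ with $S=ATB$ and $\|A\|\|B\|\le K+\gamma$. The space $Z$ has the *$K$-primary factorization property* if for every $T\in\mathcal B(Z)$ the identity $I_Z$ factors through $T$ or through $I_Z-T$ with constant $K^+$. The space $E$ has the *$K$-primary diagonal factorization property* with respect to $(e_j)$ if this holds for all $T\in\mathcal B(E)$ that are diagonal, i.e. $\langle e_k^*,Te_j\rangle=0$ for $k\neq j$. Put $\mathcal M_Z=\{T\in\mathcal B(Z): I_Z\ne ATB\text{ for all }A,B\in\mathcal B(Z)\}$. The space $Z$ is *primary* if whenever $Z=F\oplus G$ with closed subspaces $F,G$, then $F$ or $G$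 is isomorphic to $Z$. The space $E$ is *asymptotically curved* with respect to $(e_j)$ if $\lim_n\frac1n\|\sum_{j=1}^n x_j\|=0$ for every bounded block basis $(x_j)$ of $(e_j)$. Two sequences $(x_k)$, $(y_k)$ in normed spaces are *impartially $K$-equivalent* if $\frac1{\sqrt K}\|\sum a_ky_k\|\le\|\sum a_kx_k\|\le\sqrt K\|\sum a_ky_k\|$ for all finitely supported real sequences $(a_k)$. The basis $(e_j)$ is *$C_r$-strategically reproducible in $E$ with projectional factors* if for every $\eta>0$ player (II) has a winning strategy in the following infinite game. First, player (I) chooses a partition $\mathbb N=N_1\cup N_2$ (one of the sets may be empty). In turn $k=1,2,\dots$: player (I) chooses $\eta_k>0$, a closed subspace $W_k\subset E$ of finite codimension and a weak* closed subspace $G_k\subset E^*$ of finite codimension; then player (II) chooses $i_k\in\{1,2\}$, a finite set $E_k\subset N_{i_k}$ and non-negative reals $(\lambda^k_j)_{j\in E_k}$, $(\mu^k_j)_{j\in E_k}$ with $1-\eta<\sum_{j\in E_k}\lambda^k_j\mu^k_j<1+\eta$; then player (I) chooses signs $(\varepsilon^k_j)_{j\in E_k}\in\{\pm1\}^{E_k}$.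 Put $x_k=\sum_{j\in E_k}\varepsilon^k_j\lambda^k_je_j$ and $x_k^*=\sum_{j\in E_k}\varepsilon^k_j\mu^k_je_j^*$. Player (II) wins if $(x_k)$ and $(e_k)$ are impartially $(C_r+\eta)$-equivalent, $(x_k^*)$ and $(e_k^*)$ are impartially $(C_r+\eta)$-equivalent, $\operatorname{dist}(x_k,W_k)<\eta_k$ and $\operatorname{dist}(x_k^*,G_k)<\eta_k$ for all $k$, and $\langle x_k^*,x_l\rangle=\delta_{kl}$ for all $k,l$. **Theorem.** Suppose that $(e_j)$ is $C_r$-strategically reproducible in $E$ with projectional factors and that $E$ has the $C$-primary diagonal factorization property with respect to $(e_j)$. Let $Z$ be one of the following spaces: (i) $Z=E$; (ii) $Z=\ell^p(E)$ for some $1\le p<\infty$; (iii) $Z=\ell^\infty(E)$, if $E$ is asymptotically curved with respect to $(e_j)$. Then $Z$ has the $\lambda C_rC$-primary factorization property, and $\mathcal M_Z$ is the unique maximal (two-sided) ideal of $\mathcal B(Z)$. Moreover, in cases (ii) and (iii), $Z$ is primary. -/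

import Mathlib

open scoped ENNReal

namespace StratRep

noncomputable section

/-! ### Factorization of operators -/

section Factorization

variable {E : Type*} [NormedAddCommGroup E] [NormedSpace ℝ E]

/-- `S` factors through `T` with constant `C` (and error `0`):
`S = A T B` for bounded linear operators `A`, `B` on `E` with `‖A‖ ‖B‖ ≤ C`. -/
def FactorsThrough (S T : E →L[ℝ] E) (C : ℝ) : Prop :=
  ∃ A B : E →L[ℝ] E, ‖A‖ * ‖B‖ ≤ C ∧ S = A ∘L T ∘L B

/-- `S` factors through `T` with constant `C⁺`, i.e. with constant `C + γ` for every `γ > 0`. -/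
def FactorsThroughPlus (S T : E →L[ℝ] E) (C : ℝ) : Prop :=
  ∀ γ : ℝ, 0 < γ → FactorsThrough S T (C + γ)

variable (E) in
/-- The `C`-primary factorization property: for every bounded linear operator `T` on `E`, the
identity of `E` factors through `T` or through `I - T` with constant `C⁺`. -/
def HasPrimaryFactorization (C : ℝ) : Prop :=
  ∀ T : E →L[ℝ] E,
    FactorsThroughPlus (ContinuousLinearMap.id ℝ E) T C ∨
      FactorsThroughPlus (ContinuousLinearMap.id ℝ E) (ContinuousLinearMap.id ℝ E - T) C

/-- A bounded linear operator `T` is diagonal with respect to a Schauder basis `(e_j)` with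
biorthogonal functionals `(e_j^*)` if `⟨e_k^*, T e_j⟩ = 0` whenever `k ≠ j`. -/
def IsDiagonal (b : SchauderBasis ℝ E) (T : E →L[ℝ] E) : Prop :=
  ∀ k j : ℕ, k ≠ j → b.coord k (T (b j)) = 0

/-- The `C`-primary diagonal factorization property with respect to a Schauder basis. -/
def HasPrimaryDiagonalFactorization (b : SchauderBasis ℝ E) (C : ℝ) : Prop :=
  ∀ T : E →L[ℝ] E, IsDiagonal b T →
    FactorsThroughPlus (ContinuousLinearMap.id ℝ E) T C ∨
      FactorsThroughPlus (ContinuousLinearMap.id ℝ E) (ContinuousLinearMap.id ℝ E - T) C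

variable (E) in
/-- The set `M_E` of all bounded linear operators on `E` through which the identity of `E` does
not factor. -/
def nonFactorSet : Set (E →L[ℝ] E) :=
  {T | ∀ A B : E →L[ℝ] E, ContinuousLinearMap.id ℝ E ≠ A ∘L T ∘L B}

variable (E) in
/-- `M_E` is a two-sided ideal of the algebra of bounded linear operators on `E`, it is a maximal
ideal, and it is the only one. -/
def NonFactorSetIsUniqueMaximalIdeal : Prop :=
  ∃ I : TwoSidedIdeal (E →L[ℝ] E), (I : Set (E →L[ℝ] E)) = nonFactorSet E ∧
    ∀ J : TwoSidedIdeal (E →L[ℝ] E), IsCoatom J ↔ J = I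

variable (E) in
/-- `E` is primary: whenever `E` is the direct sum of two closed subspaces `F` and `G`, at least
one of them is isomorphic to `E`. -/
def IsPrimarySpace : Prop :=
  ∀ F G : Submodule ℝ E, IsClosed (F : Set E) → IsClosed (G : Set E) → IsCompl F G →
    Nonempty (F ≃L[ℝ] E) ∨ Nonempty (G ≃L[ℝ] E)

end Factorization

/-! ### Asymptotically curved spaces -/

section Curved

variable {E : Type*} [NormedAddCommGroup E] [NormedSpace ℝ E]

/-- `(x_j)` is a block basis of `(e_j)`: nonzero vectors, each a finite linear combination of the
`e_i` with `i` in one of successive intervals. -/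
def IsBlockBasis (b : SchauderBasis ℝ E) (x : ℕ → E) : Prop :=
  ∃ p : ℕ → ℕ, StrictMono p ∧
    ∀ j, x j ≠ 0 ∧ x j ∈ Submodule.span ℝ (b '' Set.Ico (p j) (p (j + 1)))

/-- `E` is asymptotically curved with respect to `(e_j)`: the arithmetic means of every bounded
block basis of `(e_j)` tend to zero in norm. -/
def IsAsymptoticallyCurved (b : SchauderBasis ℝ E) : Prop :=
  ∀ x : ℕ → E, IsBlockBasis b x → (∃ M : ℝ, ∀ j, ‖x j‖ ≤ M) →
    Filter.Tendsto (fun n : ℕ => (1 / (n : ℝ)) * ‖∑ j ∈ Finset.range n, x j‖)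
      Filter.atTop (nhds 0)

end Curved

/-! ### Strategically reproducible bases -/

/-- Two sequences are impartially `C`-equivalent. -/
def ImpartiallyEquivalent {E F : Type*} [NormedAddCommGroup E] [NormedSpace ℝ E]
    [NormedAddCommGroup F] [NormedSpace ℝ F] (C : ℝ) (x : ℕ → E) (y : ℕ → F) : Prop :=
  ∀ a : ℕ →₀ ℝ,
    1 / √C * ‖a.sum fun j c => c • y j‖ ≤ ‖a.sum fun j c => c • x j‖ ∧
      ‖a.sum fun j c => c • x j‖ ≤ √C * ‖a.sum fun j c => c • y j‖

section Game

variable (E : Type*) [NormedAddCommGroup E] [NormedSpace ℝ E]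

/-- The move of player (I) in Step 1 of a turn: a number `η_k > 0`, a closed subspace `W_k` of
`E` of finite codimension, and a weak* closed subspace `G_k` of the dual of `E` of finite
codimension. -/
structure Challenge where
  tol : ℝ
  tol_pos : 0 < tol
  W : Submodule ℝ E
  W_closed : IsClosed (W : Set E)
  W_cofinite : FiniteDimensional ℝ (E ⧸ W)
  G : Submodule ℝ (StrongDual ℝ E)
  G_closed : IsClosed (StrongDual.toWeakDual '' (G : Set (StrongDual ℝ E)))
  G_cofinite : FiniteDimensional ℝ (StrongDual ℝ E ⧸ G)

/-- The move of player (II) in Step 2 of a turn: an index `i_k` of a cell of the partition, a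
finite set `E_k`, and the coefficients `λ_j^k`, `μ_j^k` (only their values for `j ∈ E_k` matter).
The rules that such a move has to obey are in `Response.IsLegal`. -/
structure Response where
  cell : Fin 2
  supp : Finset ℕ
  lam : ℕ → ℝ
  mu : ℕ → ℝ

/-- A move of player (I) in Step 3 of a turn: signs `ε_j^k` (only those with `j ∈ E_k` matter). -/
abbrev Signs : Type := ℕ → ℤˣ

/-- A strategy of player (II): the response in turn `k` is a function of the moves of player (I)
up to that point, i.e. of the challenges of turns `0, …, k` and of the signs chosen in turns
`0, …, k - 1`. -/
abbrev Strategy : Type _ :=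
  (k : ℕ) → (Fin (k + 1) → Challenge E) → (Fin k → Signs) → Response

variable {E}

/-- The rules for the move of player (II) in the game with parameter `η`, after player (I) has
chosen the partition `ℕ = N 0 ∪ N 1`. -/
def Response.IsLegal (N : Fin 2 → Set ℕ) (η : ℝ) (r : Response) : Prop :=
  (r.supp : Set ℕ) ⊆ N r.cell ∧
    (∀ j ∈ r.supp, 0 ≤ r.lam j ∧ 0 ≤ r.mu j) ∧
    1 - η < ∑ j ∈ r.supp, r.lam j * r.mu j ∧
    ∑ j ∈ r.supp, r.lam j * r.mu j < 1 + η

/-- The response of player (II) in turn `k`, if he follows the strategy `σ` and player (I) plays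
the challenges `c 0, c 1, …` and the signs `ε 0, ε 1, …`. -/
def Strategy.response (σ : Strategy E) (c : ℕ → Challenge E) (ε : ℕ → Signs) (k : ℕ) : Response :=
  σ k (fun i => c i) (fun i => ε i)

/-- The vector `x_k = ∑_{j ∈ E_k} ε_j^k λ_j^k e_j`. -/
def Response.vec (b : SchauderBasis ℝ E) (r : Response) (ε : Signs) : E :=
  ∑ j ∈ r.supp, (((ε j : ℤ) : ℝ) * r.lam j) • b j

/-- The functional `x_k^* = ∑_{j ∈ E_k} ε_j^k μ_j^k e_j^*`. -/
def Response.functional (b : SchauderBasis ℝ E) (r : Response) (ε : Signs) : StrongDual ℝ E :=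
  ∑ j ∈ r.supp, (((ε j : ℤ) : ℝ) * r.mu j) • b.coord j

/-- The demands on the outcome of the game with parameters `C`, `η`, where `x_k`, `x_k^*` are the
resulting vectors and functionals and `c_k` are the challenges of player (I). -/
def IsWinningOutcome (b : SchauderBasis ℝ E) (C η : ℝ) (c : ℕ → Challenge E)
    (x : ℕ → E) (xs : ℕ → StrongDual ℝ E) : Prop :=
  ImpartiallyEquivalent (C + η) x (fun k => b k) ∧
    ImpartiallyEquivalent (C + η) xs (fun k => b.coord k) ∧
    (∀ k, Metric.infDist (x k) ((c k).W : Set E) < (c k).tol) ∧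
    (∀ k, Metric.infDist (xs k) ((c k).G : Set (StrongDual ℝ E)) < (c k).tol)

/-- The Schauder basis `(e_j)` is `C`-strategically reproducible with projectional factors: for
every `η > 0` and every partition `ℕ = N 0 ∪ N 1` chosen by player (I) before the first turn,
player (II) has a strategy which, against all moves of player (I), produces legal moves and an
outcome that satisfies the demands of the game, and such that in addition `(x_k^*)` is
biorthogonal to `(x_k)`. -/
def IsStrategicallyReproducibleProj (b : SchauderBasis ℝ E) (C : ℝ) : Prop :=
  ∀ η : ℝ, 0 < η → ∀ N : Fin 2 → Set ℕ, N 0 ∪ N 1 = Set.univ → Disjoint (N 0) (N 1) →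
    ∃ σ : Strategy E, ∀ (c : ℕ → Challenge E) (ε : ℕ → Signs),
      (∀ k, (σ.response c ε k).IsLegal N η) ∧
      IsWinningOutcome b C η c
        (fun k => (σ.response c ε k).vec b (ε k))
        (fun k => (σ.response c ε k).functional b (ε k)) ∧
      ∀ k l, (σ.response c ε k).functional b (ε k) ((σ.response c ε l).vec b (ε l)) =
        if k = l then 1 else 0

end Game

end

end StratRep

open StratRep

/-!
Player (II)'s strategy, played simultaneously in one game for each summand of `Z` against challenges
that depend on the earlier moves, yields operators `A` and `B` on `Z` with `B A = 1` and
`‖B‖ ‖A‖ ≤ λ C_r + t` such that all off-diagonal matrix entries of `B T A` are tiny. A perturbation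
of small norm makes them vanish. For `Z = E` the diagonal factorization property then applies. For
`Z = ℓ^p(E)` one is left with an operator whose blocks are all diagonal; the identity of `E` factors
through infinitely many of its diagonal blocks, or through infinitely many of the complementary
ones, and the factorizations are assembled coordinatewise.

For `p = ∞` an operator is not determined by its matrix: a part `S` annihilating all finitely
supported sequences may remain. A functional with that property is bounded, by its norm, on sums of
almost disjointly supported unit vectors, so each coordinate of `S` vanishes on `ℓ^∞(s)` for all but
countably many members `s` of an almost disjoint family of subsets of `ℕ`. As some such family of
infinite sets is uncountable, `S` vanishes on `ℓ^∞(s)` for an infinite `s`, and one works with the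
summands in `s` only.

Primary factorization makes `M_Z` closed under addition, hence the largest proper ideal, and
Pełczyński's decomposition method turns it into primariness when `Z ≃ ℓ^p(Z)`.
-/

namespace StratRep

open Filter Topology ContinuousLinearMap

section MaximalIdeal

theorem forall_isCoatom_iff_eq_of_forall_le {α : Type*} [PartialOrder α] [OrderTop α] {a : α}
    (ha : a ≠ ⊤) (h : ∀ c, c ≠ ⊤ → c ≤ a) (c : α) : IsCoatom c ↔ c = a := by
  have ha' : IsCoatom a := ⟨ha, fun d had => by_contra fun hd => (h d hd).not_gt had⟩
  exact ⟨fun hc => (hc.le_iff_eq ha).1 (h c hc.1) |>.symm, fun hc => hc ▸ ha'⟩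

theorem twoSidedIdeal_eq_top_of_one_eq_mul_mul {R : Type*} [Ring R] {J : TwoSidedIdeal R} {t : R}
    (ht : t ∈ J) {a c : R} (h : 1 = a * (t * c)) : J = ⊤ :=
  J.one_mem_iff.1 (h ▸ J.mul_mem_left _ _ (J.mul_mem_right _ _ ht))

end MaximalIdeal

section Factorization

variable {E : Type*} [NormedAddCommGroup E] [NormedSpace ℝ E]

theorem zero_mem_nonFactorSet [Nontrivial E] : (0 : E →L[ℝ] E) ∈ nonFactorSet E := by
  intro A B hAB
  rw [zero_comp, comp_zero] at hAB
  exact one_ne_zero (α := E →L[ℝ] E) hAB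

theorem comp_mem_nonFactorSet {T : E →L[ℝ] E} (hT : T ∈ nonFactorSet E) (A B : E →L[ℝ] E) :
    A ∘L T ∘L B ∈ nonFactorSet E :=
  fun A' B' h => hT (A' ∘L A) (B ∘L B') h

theorem FactorsThroughPlus.notMem_nonFactorSet {T : E →L[ℝ] E} {K : ℝ}
    (h : FactorsThroughPlus (.id ℝ E) T K) : T ∉ nonFactorSet E := by
  obtain ⟨A, B, -, hAB⟩ := h 1 one_pos
  exact fun hT => hT A B hAB

theorem HasPrimaryFactorization.add_mem_nonFactorSet {K : ℝ} (h : HasPrimaryFactorization E K)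
    {S T : E →L[ℝ] E} (hS : S ∈ nonFactorSet E) (hT : T ∈ nonFactorSet E) :
    S + T ∈ nonFactorSet E := by
  intro A B hAB
  have hsub : .id ℝ E - A ∘L S ∘L B = A ∘L T ∘L B := by
    rw [hAB, add_comp, comp_add, add_sub_cancel_left]
  rcases h (A ∘L S ∘L B) with h | h
  · exact h.notMem_nonFactorSet (comp_mem_nonFactorSet hS A B)
  · exact (hsub ▸ h).notMem_nonFactorSet (comp_mem_nonFactorSet hT A B)

theorem HasPrimaryFactorization.nonFactorSetIsUniqueMaximalIdeal [Nontrivial E] {K : ℝ}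
    (h : HasPrimaryFactorization E K) : NonFactorSetIsUniqueMaximalIdeal E := by
  let I : TwoSidedIdeal (E →L[ℝ] E) := .mk' (nonFactorSet E) zero_mem_nonFactorSet
    h.add_mem_nonFactorSet
    (fun {S} hS => by simpa using! comp_mem_nonFactorSet hS (-1) 1)
    (fun {S _} hT => comp_mem_nonFactorSet hT S 1) (fun {_ T} hS => comp_mem_nonFactorSet hS 1 T)
  have hI (T) : T ∈ I ↔ T ∈ nonFactorSet E := TwoSidedIdeal.mem_mk' ..
  have hI_ne_top : I ≠ ⊤ := fun hI_top => (hI 1).1 (I.one_mem_iff.2 hI_top) 1 1 rfl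
  exact ⟨I, Set.ext hI, forall_isCoatom_iff_eq_of_forall_le hI_ne_top fun J hJ T hTJ =>
    (hI T).2 fun _ _ hAB => hJ (twoSidedIdeal_eq_top_of_one_eq_mul_mul hTJ hAB)⟩

theorem FactorsThrough.mono {S T : E →L[ℝ] E} {K K' : ℝ} (h : FactorsThrough S T K)
    (hK : K ≤ K') : FactorsThrough S T K' :=
  let ⟨A, B, hAB, hS⟩ := h
  ⟨A, B, hAB.trans hK, hS⟩

theorem FactorsThrough.trans {S T U : E →L[ℝ] E} {K L : ℝ} (hST : FactorsThrough S T K)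
    (hTU : FactorsThrough T U L) : FactorsThrough S U (K * L) := by
  obtain ⟨A, B, hAB, rfl⟩ := hST
  obtain ⟨A', B', hAB', rfl⟩ := hTU
  refine ⟨A ∘L A', B' ∘L B, ?_, rfl⟩
  calc ‖A ∘L A'‖ * ‖B' ∘L B‖ ≤ (‖A‖ * ‖A'‖) * (‖B'‖ * ‖B‖) := by
        gcongr <;> exact opNorm_comp_le _ _
    _ = (‖A‖ * ‖B‖) * (‖A'‖ * ‖B'‖) := by ring
    _ ≤ K * L := mul_le_mul hAB hAB' (by positivity) (le_trans (by positivity) hAB)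

theorem exists_left_inverse_of_norm_one_sub_le [CompleteSpace E] {T : E →L[ℝ] E} {ε : ℝ}
    (hT : ‖1 - T‖ ≤ ε) (hε : ε < 1) : ∃ V : E →L[ℝ] E, ‖V‖ ≤ (1 - ε)⁻¹ ∧ V * T = 1 := by
  obtain ⟨u, hu⟩ : IsUnit T := by simpa using isUnit_one_sub_of_norm_lt_one (hT.trans_lt hε)
  subst hu
  refine ⟨↑u⁻¹, opNorm_le_bound _ (by rw [inv_nonneg]; linarith) fun x => ?_, u.inv_mul⟩
  set y := (↑u⁻¹ : E →L[ℝ] E) x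
  have hxy : (u : E →L[ℝ] E) y = x := congr($u.mul_inv x)
  have hdiff : ‖y‖ - ‖x‖ ≤ ε * ‖y‖ := by
    calc ‖y‖ - ‖x‖ ≤ ‖(1 - (u : E →L[ℝ] E)) y‖ := by
          rw [_root_.sub_apply, hxy]; exact norm_sub_norm_le y x
      _ ≤ ε * ‖y‖ := le_of_opNorm_le _ hT y
  rw [inv_mul_eq_div, le_div_iff₀ (by linarith)]
  linarith

theorem FactorsThrough.of_norm_sub_le [CompleteSpace E] {D D' : E →L[ℝ] E} {K ε : ℝ}
    (h : FactorsThrough (.id ℝ E) D K) (hD : ‖D - D'‖ ≤ ε) (hε : ε * K < 1) :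
    FactorsThrough (.id ℝ E) D' ((1 - ε * K)⁻¹ * K) := by
  obtain ⟨R, S, hRS, hid⟩ := h
  have hdist : ‖1 - R ∘L D' ∘L S‖ ≤ ε * K := by
    calc ‖1 - R ∘L D' ∘L S‖ = ‖R ∘L (D - D') ∘L S‖ := by
          rw [one_def, hid, sub_comp, comp_sub]
      _ ≤ ‖R‖ * (‖D - D'‖ * ‖S‖) :=
          (opNorm_comp_le _ _).trans (by gcongr; exact opNorm_comp_le _ _)
      _ = ‖D - D'‖ * (‖R‖ * ‖S‖) := by ring
      _ ≤ ε * K := mul_le_mul hD hRS (by positivity) ((norm_nonneg _).trans hD)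
  obtain ⟨V, hV, hVid⟩ := exists_left_inverse_of_norm_one_sub_le hdist hε
  have hcompress : FactorsThrough (.id ℝ E) (R ∘L D' ∘L S) (1 - ε * K)⁻¹ :=
    ⟨V, .id ℝ E, (mul_le_of_le_one_right (norm_nonneg V) norm_id_le).trans hV, hVid.symm⟩
  exact hcompress.trans ⟨R, S, hRS, rfl⟩

theorem HasPrimaryFactorization.of_forall_pos {K : ℝ}
    (h : ∀ (T : E →L[ℝ] E) (γ : ℝ), 0 < γ →
      FactorsThrough (.id ℝ E) T (K + γ) ∨ FactorsThrough (.id ℝ E) (.id ℝ E - T) (K + γ)) :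
    HasPrimaryFactorization E K := by
  intro T
  by_contra! hcon
  simp only [FactorsThroughPlus, not_forall] at hcon
  obtain ⟨⟨γ₁, hγ₁, h₁⟩, γ₂, hγ₂, h₂⟩ := hcon
  rcases h T (min γ₁ γ₂) (lt_min hγ₁ hγ₂) with h | h
  · exact h₁ (h.mono (by gcongr; exact min_le_left _ _))
  · exact h₂ (h.mono (by gcongr; exact min_le_right _ _))

theorem HasPrimaryFactorization.of_compression [CompleteSpace E] {K C : ℝ}
    (h : ∀ (T : E →L[ℝ] E) (t : ℝ), 0 < t → ∃ A B D : E →L[ℝ] E,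
      B ∘L A = .id ℝ E ∧ ‖B‖ * ‖A‖ ≤ K + t ∧ ‖D - B ∘L T ∘L A‖ ≤ t ∧
      (FactorsThrough (.id ℝ E) D (C + t) ∨ FactorsThrough (.id ℝ E) (.id ℝ E - D) (C + t))) :
    HasPrimaryFactorization E (K * C) := by
  refine .of_forall_pos fun T γ hγ => ?_
  obtain ⟨t, ht, hsmall, hK⟩ : ∃ t : ℝ, 0 < t ∧ t * (C + t) < 1 ∧
      (1 - t * (C + t))⁻¹ * (C + t) * (K + t) < K * C + γ := by
    have hsmall : ContinuousAt (fun t : ℝ => t * (C + t)) 0 := by fun_prop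
    have hK : ContinuousAt (fun t : ℝ => (1 - t * (C + t))⁻¹ * (C + t) * (K + t)) 0 :=
      .mul (.mul (.inv₀ (by fun_prop) (by simp)) (by fun_prop)) (by fun_prop)
    have hlim := (hsmall.tendsto.eventually_lt_const (u := 1) (by simp)).and
      (hK.tendsto.eventually_lt_const (u := K * C + γ) (by simpa [mul_comm C K] using hγ))
    have hpos : ∀ᶠ t : ℝ in 𝓝[>] 0, 0 < t := self_mem_nhdsWithin
    exact (hpos.and (hlim.filter_mono nhdsWithin_le_nhds)).exists
  obtain ⟨A, B, D, hBA, hAB, hD, hfac⟩ := h T t ht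
  have hcomp (U : E →L[ℝ] E) : FactorsThrough (B ∘L U ∘L A) U (K + t) := ⟨B, A, hAB, rfl⟩
  have hone_sub : B ∘L (.id ℝ E - T) ∘L A = .id ℝ E - B ∘L T ∘L A := by
    rw [sub_comp, comp_sub, id_comp, hBA]
  refine hfac.imp (fun hfac => ?_) (fun hfac => ?_)
  · exact ((hfac.of_norm_sub_le hD hsmall).trans (hcomp T)).mono hK.le
  · rw [← norm_neg, neg_sub, ← sub_sub_sub_cancel_left _ _ (.id ℝ E), ← hone_sub] at hD
    exact ((hfac.of_norm_sub_le hD hsmall).trans (hcomp _)).mono hK.le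

end Factorization

section Diagonalization

variable {E ι : Type*} [NormedAddCommGroup E] [NormedSpace ℝ E] [CompleteSpace E]
  [DecidableEq ι]

theorem exists_small_offDiagonal (u : ι → E) (φ : ι → StrongDual ℝ E)
    (hφ : ∀ n m, φ n (u m) = if n = m then 1 else 0) (D : E →L[ℝ] E) {w : ι × ι → ℝ} {s : ℝ}
    (hw : HasSum w s) (hw_nonneg : 0 ≤ w)
    (hD : ∀ n m, n ≠ m → |φ n (D (u m))| * (‖u n‖ * ‖φ m‖) ≤ w (n, m)) :
    ∃ X : E →L[ℝ] E, ‖X‖ ≤ s ∧ ∀ n m, n ≠ m → φ n ((D - X) (u m)) = 0 := by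
  let F : ι × ι → E →L[ℝ] E := fun q =>
    if q.1 = q.2 then 0 else φ q.1 (D (u q.2)) • (φ q.2).smulRight (u q.1)
  have hFw (q) : ‖F q‖ ≤ w q := by
    by_cases hq : q.1 = q.2
    · simpa [F, hq] using hw_nonneg q
    · simpa [F, hq, norm_smul, mul_comm] using hD _ _ hq
  have hF : Summable F := .of_norm_bounded hw.summable hFw
  refine ⟨∑' q, F q, tsum_of_norm_bounded hw hFw, fun n m hnm => ?_⟩
  have hsum : HasSum (fun q => φ n (F q (u m))) (φ n ((∑' q, F q) (u m))) :=
    (hF.hasSum.mapL (apply ℝ E (u m))).mapL (φ n)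
  have hoff (q) (hq : q ≠ (n, m)) : φ n (F q (u m)) = 0 := by
    rcases q with ⟨k, l⟩
    by_cases hkl : k = l
    · simp [F, hkl]
    · have hentry : φ n (F (k, l) (u m)) = φ k (D (u l)) * (φ l (u m) * φ n (u k)) := by
        simp [F, hkl]
      rw [hentry, hφ, hφ]
      grind
  have hentry : φ n (F (n, m) (u m)) = φ n (D (u m)) := by simp [F, hφ, hnm]
  rw [_root_.sub_apply, map_sub, hsum.unique (hasSum_single _ hoff), hentry, sub_self]

end Diagonalization

section Challenges

theorem norm_apply_le_of_infDist_lt {𝕜 V : Type*} [NontriviallyNormedField 𝕜]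
    [NormedAddCommGroup V] [NormedSpace 𝕜 V] {W : Submodule 𝕜 V} {f : StrongDual 𝕜 V}
    (hf : W ≤ f.ker) {x : V} {r : ℝ} (hx : Metric.infDist x (W : Set V) < r) :
    ‖f x‖ ≤ r * ‖f‖ := by
  obtain ⟨w, hw, hxw⟩ := (Metric.infDist_lt_iff ⟨0, W.zero_mem⟩).1 hx
  have hfw : f w = 0 := hf hw
  calc ‖f x‖ = ‖f (x - w)‖ := by rw [map_sub, hfw, sub_zero]
    _ ≤ ‖f‖ * ‖x - w‖ := f.le_opNorm _
    _ ≤ r * ‖f‖ := by rw [mul_comm, ← dist_eq_norm]; gcongr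

variable {E α β : Type*} [NormedAddCommGroup E] [NormedSpace ℝ E]

theorem finiteDimensional_quotient_iInf_ker [Finite α] {𝕜 V : Type*} [Field 𝕜]
    [AddCommGroup V] [Module 𝕜 V] (f : α → V →ₗ[𝕜] 𝕜) :
    FiniteDimensional 𝕜 (V ⧸ ⨅ i, LinearMap.ker (f i)) := by
  rw [← LinearMap.ker_pi]
  exact Module.Finite.equiv (LinearMap.quotKerEquivRange (LinearMap.pi f)).symm

theorem isClosed_toWeakDual_image_iInf_ker_apply (v : β → E) :
    IsClosed (StrongDual.toWeakDual ''
      ((⨅ j, (apply ℝ ℝ (v j)).ker : Submodule ℝ (StrongDual ℝ E)) : Set (StrongDual ℝ E))) := by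
  have himage : StrongDual.toWeakDual ''
      ((⨅ j, (apply ℝ ℝ (v j)).ker : Submodule ℝ (StrongDual ℝ E)) : Set (StrongDual ℝ E)) =
      ⋂ j, {g : WeakDual ℝ E | g (v j) = 0} := by
    rw [LinearEquiv.image_eq_preimage_symm]
    ext g
    simp
  rw [himage]
  exact isClosed_iInter fun j => isClosed_eq (WeakDual.eval_continuous _) continuous_const

variable [Finite α] [Finite β]

/-- The challenge to come `tol`-close to the annihilators of finitely many functionals and of
finitely many vectors. -/
noncomputable def Challenge.ofFinite (f : α → StrongDual ℝ E) (v : β → E) (tol : ℝ)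
    (tol_pos : 0 < tol) : Challenge E where
  tol := tol
  tol_pos := tol_pos
  W := ⨅ i, (f i).ker
  W_closed := by
    rw [Submodule.coe_iInf]
    exact isClosed_iInter fun i => (f i).isClosed_ker
  W_cofinite := finiteDimensional_quotient_iInf_ker _
  G := ⨅ j, (apply ℝ ℝ (v j)).ker
  G_closed := isClosed_toWeakDual_image_iInf_ker_apply v
  G_cofinite := finiteDimensional_quotient_iInf_ker _

instance Challenge.instNonempty : Nonempty (Challenge E) :=
  ⟨.ofFinite (α := Empty) (β := Empty) nofun nofun 1 one_pos⟩

/-- The vector `x` and the functional `g` meet the demands of player (I) on the turn in which he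
plays `c`. -/
def Challenge.IsMetBy (c : Challenge E) (x : E) (g : StrongDual ℝ E) : Prop :=
  Metric.infDist x (c.W : Set E) < c.tol ∧ Metric.infDist g (c.G : Set (StrongDual ℝ E)) < c.tol

theorem exists_challenge_forall_abs_le (f : α → StrongDual ℝ E) (v : β → E) {δ : α → ℝ}
    {ε : β → ℝ} (hδ : ∀ i, 0 < δ i) (hε : ∀ j, 0 < ε j) :
    ∃ c : Challenge E, ∀ x g, c.IsMetBy x g →
      (∀ i, |f i x| ≤ δ i) ∧ ∀ j, |g (v j)| ≤ ε j := by
  have hsmall {a r : ℝ} (hr : 0 < r) : ∀ᶠ t in 𝓝[>] 0, t * a ≤ r := by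
    have hlim : Tendsto (fun t : ℝ => t * a) (𝓝 0) (𝓝 0) :=
      (continuous_mul_const a).tendsto' 0 0 (zero_mul a)
    exact (hlim.mono_left nhdsWithin_le_nhds).eventually_le_const hr
  obtain ⟨t, ht, hδt, hεt⟩ : ∃ t, 0 < t ∧ (∀ i, t * ‖f i‖ ≤ δ i) ∧
      ∀ j, t * ‖apply ℝ ℝ (v j)‖ ≤ ε j :=
    ((eventually_mem_nhdsWithin (s := Set.Ioi 0)).and <| (eventually_all.2 fun i =>
      hsmall (hδ i)).and (eventually_all.2 fun j => hsmall (hε j))).exists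
  exact ⟨.ofFinite f v t ht, fun x g h =>
    ⟨fun i => (norm_apply_le_of_infDist_lt (iInf_le _ i) h.1).trans (hδt i),
      fun j => (norm_apply_le_of_infDist_lt (f := apply ℝ ℝ (v j)) (iInf_le _ j) h.2).trans
        (hεt j)⟩⟩

end Challenges

section Outcomes

variable {E : Type*} [NormedAddCommGroup E] [NormedSpace ℝ E]

/-- A pair of sequences in `E` and `E^*` which is biorthogonal and equivalent, on both sides, to
the basis and its coordinate functionals: the outcome of a game won by player (II). -/
structure IsBiorthogonalCopy (b : SchauderBasis ℝ E) (K : ℝ) (x : ℕ → E)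
    (g : ℕ → StrongDual ℝ E) : Prop where
  vec_equiv : ImpartiallyEquivalent K x (fun k => b k)
  functional_equiv : ImpartiallyEquivalent K g (fun k => b.coord k)
  biorthogonal : ∀ k l, g k (x l) = if k = l then 1 else 0

/-- Player (I) offers the partition `ℕ = ℕ ∪ ∅` and always plays the signs `+1`. -/
theorem IsStrategicallyReproducibleProj.exists_causal_outcome {b : SchauderBasis ℝ E} {Cr : ℝ}
    (hrep : IsStrategicallyReproducibleProj b Cr) {η : ℝ} (hη : 0 < η) :
    ∃ (x : (ℕ → Challenge E) → ℕ → E) (g : (ℕ → Challenge E) → ℕ → StrongDual ℝ E),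
      (∀ c c' k, (∀ t ≤ k, c t = c' t) → x c k = x c' k ∧ g c k = g c' k) ∧
      ∀ c, IsBiorthogonalCopy b (Cr + η) (x c) (g c) ∧ ∀ k, (c k).IsMetBy (x c k) (g c k) := by
  obtain ⟨σ, hσ⟩ := hrep η hη ![Set.univ, ∅] (by simp) (by simp)
  refine ⟨fun c k => (σ.response c 1 k).vec b 1, fun c k => (σ.response c 1 k).functional b 1,
    fun c c' k hcc' => ?_, fun c => ?_⟩
  · have hresponse : σ.response c 1 k = σ.response c' 1 k :=
      congrArg (σ k · _) (funext fun t => hcc' t (Nat.lt_succ_iff.1 t.2))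
    simp only [hresponse, and_self]
  · obtain ⟨-, ⟨hx, hg, hW, hG⟩, hxg⟩ := hσ c 1
    exact ⟨⟨hx, hg, hxg⟩, fun k => ⟨hW k, hG k⟩⟩

theorem exists_eq_self_of_causal {Q β : Type*} [Nonempty β] (time : Q → ℕ)
    (H : (Q → β) → Q → β)
    (hH : ∀ c c' q, (∀ q', time q' < time q → c q' = c' q') → H c q = H c' q) :
    ∃ c, H c = c := by
  classical
  let c : Q → β := (measure time).wf.fix fun q past =>
    H (fun q' => if h : time q' < time q then past q' h else Classical.arbitrary β) q
  refine ⟨c, funext fun q => ?_⟩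
  rw [show c q = _ from WellFounded.fix_eq ..]
  exact hH _ _ _ fun q' hq' => by rw [dif_pos hq']

section Interleaving

variable {ι : Type*} [Encodable ι]

/-- A schedule for the simultaneous play of games indexed by `ι`: turn `k` of game `i` takes place
at time `playTime (i, k)`. -/
def playTime (q : ι × ℕ) : ℕ := Nat.pair (Encodable.encode q.1) q.2

theorem playTime_injective : Function.Injective (playTime (ι := ι)) := fun q q' h => by
  obtain ⟨h₁, h₂⟩ := Nat.pair_eq_pair.1 h
  exact Prod.ext (Encodable.encode_injective h₁) h₂

theorem playTime_mono_right (i : ι) : Monotone fun k => playTime (i, k) :=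
  monotone_nat_of_le_succ fun k => (Nat.pair_lt_pair_right _ k.lt_succ_self).le

instance finite_playTime_lt (n : ℕ) : Finite {q : ι × ℕ // playTime q < n} :=
  .of_injective (fun q => (⟨playTime q.1, q.2⟩ : Fin n)) fun _ _ h =>
    Subtype.ext (playTime_injective (Fin.mk.inj h))

variable {b : SchauderBasis ℝ E} {Cr η : ℝ}

theorem IsStrategicallyReproducibleProj.exists_interleaved_outcome
    (hrep : IsStrategicallyReproducibleProj b Cr) (hη : 0 < η)
    (ch : (q : ι × ℕ) → ({q' : ι × ℕ // playTime q' < playTime q} → E × StrongDual ℝ E) →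
      Challenge E) :
    ∃ (x : ι × ℕ → E) (g : ι × ℕ → StrongDual ℝ E),
      (∀ i, IsBiorthogonalCopy b (Cr + η) (fun k => x (i, k)) (fun k => g (i, k))) ∧
      ∀ q, (ch q fun q' => (x q', g q')).IsMetBy (x q) (g q) := by
  obtain ⟨x, g, hcausal, hwin⟩ := hrep.exists_causal_outcome hη
  obtain ⟨c, hc⟩ := exists_eq_self_of_causal playTime
    (fun c q => ch q fun q' => (x (fun t => c (q'.1.1, t)) q'.1.2,
      g (fun t => c (q'.1.1, t)) q'.1.2)) fun c c' q hcc' => by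
        refine congrArg (ch q) (funext fun q' => Prod.ext_iff.2 (hcausal _ _ _ fun t ht => ?_))
        exact hcc' _ ((playTime_mono_right _ ht).trans_lt q'.2)
  refine ⟨fun q => x (fun t => c (q.1, t)) q.2, fun q => g (fun t => c (q.1, t)) q.2,
    fun i => (hwin fun t => c (i, t)).1, fun q => ?_⟩
  have := (hwin fun t => c (q.1, t)).2 q.2
  rwa [← congrFun hc q] at this

theorem IsStrategicallyReproducibleProj.exists_almost_diagonalizing_array
    (hrep : IsStrategicallyReproducibleProj b Cr) (hη : 0 < η) (T : ι → ι → E →L[ℝ] E)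
    {ε : ι × ℕ → ι × ℕ → ℝ} (hε : ∀ q q', 0 < ε q q') :
    ∃ (x : ι × ℕ → E) (g : ι × ℕ → StrongDual ℝ E),
      (∀ i, IsBiorthogonalCopy b (Cr + η) (fun k => x (i, k)) (fun k => g (i, k))) ∧
      (∀ i j, Summable fun k => ‖g (i, k) (b j)‖ * ‖b k‖) ∧
      ∀ q q', q ≠ q' → |g q (T q.1 q'.1 (x q'))| ≤ ε q q' := by
  choose ch hch using fun (q : ι × ℕ)
      (past : {q' : ι × ℕ // playTime q' < playTime q} → E × StrongDual ℝ E) =>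
    exists_challenge_forall_abs_le (fun q' => (past q').2 ∘L T q'.1.1 q.1)
      (Sum.elim (fun q' => T q.1 q'.1.1 (past q').1) fun j : Fin q.2 => b j)
      (δ := fun q' => ε q' q)
      (ε := Sum.elim (fun q' => ε q q') fun _ => (1 / 2) ^ q.2 / (1 + ‖b q.2‖))
      (fun q' => hε q' q) (Sum.forall.2 ⟨fun q' => hε q q', fun _ =>
        show (0 : ℝ) < (1 / 2) ^ q.2 / (1 + ‖b q.2‖) by positivity⟩)
  obtain ⟨x, g, hcopy, hmet⟩ := hrep.exists_interleaved_outcome hη ch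
  have hsmall (q) := hch q _ _ _ (hmet q)
  refine ⟨x, g, hcopy, fun i j => ?_, fun q q' hne => ?_⟩
  · refine .of_norm_bounded_eventually_nat summable_geometric_two ?_
    filter_upwards [eventually_gt_atTop j] with k hjk
    have hgb : ‖g (i, k) (b j)‖ ≤ (1 / 2) ^ k / (1 + ‖b k‖) :=
      (hsmall (i, k)).2 (.inr ⟨j, hjk⟩)
    rw [Real.norm_of_nonneg (by positivity)]
    calc ‖g (i, k) (b j)‖ * ‖b k‖ ≤ (1 / 2) ^ k / (1 + ‖b k‖) * (1 + ‖b k‖) := by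
          gcongr; linarith
      _ = (1 / 2) ^ k := div_mul_cancel₀ _ (by positivity)
  · rcases (playTime_injective.ne hne).lt_or_gt with hlt | hlt
    · exact (hsmall q').1 ⟨q, hlt⟩
    · exact (hsmall q).2 (.inl ⟨q', hlt⟩)

end Interleaving

end Outcomes

section Basis

variable {E F : Type*} [NormedAddCommGroup E] [NormedSpace ℝ E] [NormedAddCommGroup F]
  [NormedSpace ℝ F]

theorem coord_apply_basis (b : SchauderBasis ℝ E) (i j : ℕ) :
    b.coord i (b j) = if i = j then 1 else 0 := by
  simp [b.ortho, Pi.single_apply]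

theorem eq_zero_of_forall_coord_eq_zero (b : SchauderBasis ℝ E) {z : E}
    (h : ∀ k, b.coord k z = 0) : z = 0 :=
  tendsto_nhds_unique (b.tendsto_proj z) (by simp [h])

theorem ext_of_forall_basis (b : SchauderBasis ℝ E) {S T : E →L[ℝ] F}
    (h : ∀ j, S (b j) = T (b j)) : S = T := by
  ext z
  refine tendsto_nhds_unique ((S.continuous.tendsto z).comp (b.tendsto_proj z))
    (((T.continuous.tendsto z).comp (b.tendsto_proj z)).congr fun n => ?_)
  simp [h]

theorem exists_tendsto_apply_of_forall_basis [CompleteSpace E] [CompleteSpace F]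
    (b : SchauderBasis ℝ E) {L : ℕ → E →L[ℝ] F} {M : ℝ} (hM : ∀ n, ‖L n‖ ≤ M)
    (hb : ∀ j, CauchySeq fun n => L n (b j)) :
    ∃ S : E →L[ℝ] F, ∀ z, Tendsto (fun n => L n z) atTop (𝓝 (S z)) := by
  let Δ (p : ℕ × ℕ) : E →L[ℝ] F := L p.2 - L p.1
  have hΔM : ∃ M', ∀ p, ‖Δ p‖ ≤ M' :=
    ⟨M + M, fun p => (norm_sub_le _ _).trans (add_le_add (hM _) (hM _))⟩
  have hΔ : Equicontinuous fun p => ⇑(Δ p) :=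
    ((NormedSpace.equicontinuous_TFAE Δ).out 5 1 : _ ↔ _).1 hΔM
  have hcauchy z : CauchySeq (fun n => L n z) ↔ Tendsto (Δ · z) atTop (𝓝 0) := by
    rw [cauchySeq_iff_tendsto, uniformity_eq_comap_nhds_zero, tendsto_comap_iff]
    rfl
  have hlim z : ∃ y, Tendsto (fun n => L n z) atTop (𝓝 y) := by
    refine cauchySeq_tendsto_of_complete ((hcauchy z).2 ?_)
    refine (hΔ.isClosed_setOfPred_tendsto continuous_const).mem_of_tendsto (b.tendsto_proj z)
      (.of_forall fun m => ?_)
    have hsum : Tendsto (fun p => ∑ i ∈ Finset.range m, b.coord i z • Δ p (b i)) atTop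
        (𝓝 (∑ i ∈ Finset.range m, b.coord i z • 0)) :=
      tendsto_finsetSum _ fun i _ => ((hcauchy _).1 (hb i)).const_smul _
    simpa using hsum
  choose S hS using hlim
  exact ⟨continuousLinearMapOfTendsto L (tendsto_pi_nhds.2 hS), hS⟩

theorem sum_smul_sum_range_single (n : ℕ) (a : ℕ → ℝ) (v : ℕ → E) :
    (∑ j ∈ Finset.range n, Finsupp.single j (a j)).sum (fun j c => c • v j) =
      ∑ j ∈ Finset.range n, a j • v j := by
  rw [← Finsupp.sum_finsetSum_index (by simp) (by simp [add_smul])]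
  simp

theorem ImpartiallyEquivalent.norm_sum_range_le {K : ℝ} {x : ℕ → E} {y : ℕ → F}
    (h : ImpartiallyEquivalent K x y) (n : ℕ) (a : ℕ → ℝ) :
    ‖∑ j ∈ Finset.range n, a j • x j‖ ≤ √K * ‖∑ j ∈ Finset.range n, a j • y j‖ := by
  rw [← sum_smul_sum_range_single, ← sum_smul_sum_range_single]
  exact (h _).2

variable [CompleteSpace E]

theorem ImpartiallyEquivalent.exists_operator_map_basis [CompleteSpace F]
    {b : SchauderBasis ℝ E} {K : ℝ} {x : ℕ → F} (hx : ImpartiallyEquivalent K x fun k => b k) :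
    ∃ A : E →L[ℝ] F, ‖A‖ ≤ √K ∧ ∀ j, A (b j) = x j := by
  let L (n : ℕ) : E →L[ℝ] F := ∑ j ∈ Finset.range n, (b.coord j).smulRight (x j)
  have hL n z : ‖L n z‖ ≤ √K * ‖b.proj n z‖ := by
    simpa [L, sum_apply] using hx.norm_sum_range_le n fun j => b.coord j z
  have hL' n : ‖L n‖ ≤ √K * b.nnnormProjBound :=
    opNorm_le_bound _ (by positivity) fun z => (hL n z).trans <| by
      rw [mul_assoc]
      gcongr
      exact (b.proj n).le_of_opNorm_le (b.norm_proj_le_nnnormProjBound n) z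
  have hb j : Tendsto (fun n => L n (b j)) atTop (𝓝 (x j)) := by
    refine tendsto_const_nhds.congr' ?_
    filter_upwards [eventually_gt_atTop j] with n hn
    simp [L, sum_apply, coord_apply_basis, hn]
  obtain ⟨A, hA⟩ := exists_tendsto_apply_of_forall_basis b hL' fun j => (hb j).cauchySeq
  refine ⟨A, opNorm_le_bound _ (by positivity) fun z => ?_,
    fun j => tendsto_nhds_unique (hA _) (hb j)⟩
  exact le_of_tendsto_of_tendsto' (hA z).norm ((b.tendsto_proj z).norm.const_mul _) (hL · z)

theorem ImpartiallyEquivalent.norm_sum_smulRight_le {b : SchauderBasis ℝ E} {K : ℝ}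
    {g : ℕ → StrongDual ℝ E} (hg : ImpartiallyEquivalent K g fun k => b.coord k) (n : ℕ) :
    ‖∑ k ∈ Finset.range n, (g k).smulRight (b k)‖ ≤ b.nnnormProjBound * √K := by
  refine opNorm_le_bound _ (by positivity) fun z =>
    NormedSpace.norm_le_dual_bound ℝ _ (by positivity) fun f => ?_
  have hcoord : ∑ k ∈ Finset.range n, f (b k) • b.coord k = f ∘L b.proj n := by
    ext w
    simp [sum_apply, mul_comm]
  have hsum : ‖∑ k ∈ Finset.range n, f (b k) • g k‖ ≤ √K * (‖f‖ * b.nnnormProjBound) := by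
    refine (hg.norm_sum_range_le n fun k => f (b k)).trans ?_
    rw [hcoord]
    gcongr
    exact (opNorm_comp_le _ _).trans (by gcongr; exact b.norm_proj_le_nnnormProjBound n)
  calc ‖f ((∑ k ∈ Finset.range n, (g k).smulRight (b k)) z)‖
      = ‖(∑ k ∈ Finset.range n, f (b k) • g k) z‖ := by simp [sum_apply, mul_comm]
    _ ≤ √K * (‖f‖ * b.nnnormProjBound) * ‖z‖ := le_of_opNorm_le _ hsum z
    _ = b.nnnormProjBound * √K * ‖z‖ * ‖f‖ := by ring

theorem ImpartiallyEquivalent.exists_operator_coord_eq {b : SchauderBasis ℝ E} {K : ℝ}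
    {g : ℕ → StrongDual ℝ E} (hg : ImpartiallyEquivalent K g fun k => b.coord k)
    (hsum : ∀ j, Summable fun k => ‖g k (b j)‖ * ‖b k‖) :
    ∃ B : E →L[ℝ] E, ‖B‖ ≤ b.nnnormProjBound * √K ∧ ∀ k z, b.coord k (B z) = g k z := by
  let L (n : ℕ) : E →L[ℝ] E := ∑ k ∈ Finset.range n, (g k).smulRight (b k)
  have hcauchy j : CauchySeq fun n => L n (b j) := by
    have hj : Summable fun k => g k (b j) • b k :=
      .of_norm (by simpa only [norm_smul] using hsum j)
    simpa [L, sum_apply] using hj.hasSum.tendsto_sum_nat.cauchySeq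
  obtain ⟨B, hB⟩ := exists_tendsto_apply_of_forall_basis b hg.norm_sum_smulRight_le hcauchy
  refine ⟨B, opNorm_le_bound _ (by positivity) fun z => le_of_tendsto' (hB z).norm fun n =>
    le_of_opNorm_le _ (hg.norm_sum_smulRight_le n) z, fun k z => ?_⟩
  refine tendsto_nhds_unique (((b.coord k).continuous.tendsto _).comp (hB z))
    (tendsto_const_nhds.congr' ?_)
  filter_upwards [eventually_gt_atTop k] with n hn
  simp [sum_apply, coord_apply_basis, hn]

theorem IsBiorthogonalCopy.exists_left_inverse {b : SchauderBasis ℝ E} {K : ℝ} {x : ℕ → E}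
    {g : ℕ → StrongDual ℝ E} (h : IsBiorthogonalCopy b K x g)
    (hsum : ∀ j, Summable fun k => ‖g k (b j)‖ * ‖b k‖) :
    ∃ A B : E →L[ℝ] E, ‖A‖ ≤ √K ∧ ‖B‖ ≤ b.nnnormProjBound * √K ∧ B ∘L A = .id ℝ E ∧
      (∀ j, A (b j) = x j) ∧ ∀ k z, b.coord k (B z) = g k z := by
  obtain ⟨A, hA, hAb⟩ := h.vec_equiv.exists_operator_map_basis
  obtain ⟨B, hB, hBcoord⟩ := h.functional_equiv.exists_operator_coord_eq hsum
  refine ⟨A, B, hA, hB, ext_of_forall_basis b fun j => ?_, hAb, hBcoord⟩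
  refine sub_eq_zero.1 (eq_zero_of_forall_coord_eq_zero b fun k => ?_)
  rw [map_sub, comp_apply, hBcoord, hAb, h.biorthogonal, id_apply, coord_apply_basis, sub_self]

end Basis

section Diagonalization

variable {E Z ι : Type*} [NormedAddCommGroup E] [NormedSpace ℝ E] [CompleteSpace E]
  [NormedAddCommGroup Z] [NormedSpace ℝ Z] [CompleteSpace Z] [Encodable ι] [DecidableEq ι]
  {b : SchauderBasis ℝ E} {Cr C : ℝ}

theorem IsStrategicallyReproducibleProj.exists_diagonalizing_operators
    (hrep : IsStrategicallyReproducibleProj b Cr) (hCr : 0 ≤ Cr) {ev : ι → Z →L[ℝ] E}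
    {sg : ι → E →L[ℝ] Z} (hev : ∀ i k x, ev i (sg k x) = if i = k then x else 0)
    (T : Z →L[ℝ] Z) {t : ℝ} (ht : 0 < t) :
    ∃ (A B : ι → E →L[ℝ] E) (α β : ℝ), (∀ i, ‖A i‖ ≤ α) ∧ (∀ i, ‖B i‖ ≤ β) ∧
      β * α ≤ b.nnnormProjBound * Cr + t ∧ (∀ i, B i ∘L A i = .id ℝ E) ∧
      ∀ A' B' : Z →L[ℝ] Z, (∀ k x, A' (sg k x) = sg k (A k x)) →
        (∀ i z, ev i (B' z) = B i (ev i z)) → ∃ X : Z →L[ℝ] Z, ‖X‖ ≤ t ∧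
          ∀ i j k l, (i, j) ≠ (k, l) →
            b.coord j (ev i ((B' ∘L T ∘L A' - X) (sg k (b l)))) = 0 := by
  obtain ⟨w, hw_pos, s, hw, hst⟩ := posSumOfEncodable ht ((ι × ℕ) × (ι × ℕ))
  let u (q : ι × ℕ) : Z := sg q.1 (b q.2)
  let φ (q : ι × ℕ) : StrongDual ℝ Z := b.coord q.2 ∘L ev q.1
  obtain ⟨η, hη, hηt⟩ : ∃ η > 0, b.nnnormProjBound * η ≤ t :=
    ⟨t / (b.nnnormProjBound + 1), by positivity, by
      rw [mul_div_left_comm]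
      exact mul_le_of_le_one_right ht.le (div_le_one_of_le₀ (by linarith) (by positivity))⟩
  obtain ⟨x, g, hcopy, hsum, hsmall⟩ := hrep.exists_almost_diagonalizing_array hη
    (fun i k => ev i ∘L T ∘L sg k) (ε := fun q q' => w (q, q') / (1 + ‖u q‖ * ‖φ q'‖))
    fun q q' => div_pos (hw_pos _) (by positivity)
  choose A B hA hB hBA hAb hBcoord using fun i => (hcopy i).exists_left_inverse (hsum i)
  refine ⟨A, B, _, _, hA, hB, ?_, hBA, fun A' B' hA' hB' => ?_⟩
  · rw [mul_assoc, Real.mul_self_sqrt (by positivity), mul_add]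
    gcongr
  have hφu q q' : φ q (u q') = if q = q' then 1 else 0 := by
    simp only [φ, u, comp_apply, hev, apply_ite (b.coord q.2), coord_apply_basis, map_zero,
      ← ite_and, Prod.ext_iff]
  obtain ⟨X, hX, hXdiag⟩ := exists_small_offDiagonal u φ hφu (B' ∘L T ∘L A') hw
    (fun q => (hw_pos q).le) fun q q' hne => by
      have hentry : φ q ((B' ∘L T ∘L A') (u q')) = g q (ev q.1 (T (sg q'.1 (x q')))) := by
        simp only [φ, u, comp_apply, hB', hA', hBcoord, hAb]
      calc |φ q ((B' ∘L T ∘L A') (u q'))| * (‖u q‖ * ‖φ q'‖)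
          ≤ w (q, q') / (1 + ‖u q‖ * ‖φ q'‖) * (1 + ‖u q‖ * ‖φ q'‖) := by
            rw [hentry]
            gcongr
            · exact div_nonneg (hw_pos _).le (by positivity)
            · exact hsmall q q' hne
            · linarith
        _ = w (q, q') := div_mul_cancel₀ _ (by positivity)
  exact ⟨X, hX.trans hst, fun i j k l hne => hXdiag (i, j) (k, l) hne⟩

theorem IsStrategicallyReproducibleProj.hasPrimaryFactorization
    (hrep : IsStrategicallyReproducibleProj b Cr) (hCr : 0 ≤ Cr)
    (hdiag : HasPrimaryDiagonalFactorization b C) :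
    HasPrimaryFactorization E (b.nnnormProjBound * Cr * C) := by
  refine .of_compression fun T t ht => ?_
  obtain ⟨A, B, α, β, hA, hB, hβα, hBA, hdiagonalize⟩ :=
    hrep.exists_diagonalizing_operators (ι := Unit) (ev := fun _ => .id ℝ E)
      (sg := fun _ => .id ℝ E) hCr (by simp) T ht
  obtain ⟨X, hX, hdiagonal⟩ := hdiagonalize (A ()) (B ()) (by simp) (by simp)
  have hnorm : ‖B ()‖ * ‖A ()‖ ≤ β * α :=
    mul_le_mul (hB ()) (hA ()) (norm_nonneg _) ((norm_nonneg _).trans (hB ()))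
  refine ⟨A (), B (), B () ∘L T ∘L A () - X, hBA (), hnorm.trans hβα, ?_, ?_⟩
  · rwa [sub_sub_cancel_left, norm_neg]
  · exact (hdiag _ fun k j hkj => hdiagonal () k () j (by simpa using hkj)).imp
      (fun h => h t ht) fun h => h t ht

end Diagonalization

section SequenceSpaces

variable {ι κ : Type*} {p : ℝ≥0∞} [Fact (1 ≤ p)]

theorem exponent_pos (p : ℝ≥0∞) [Fact (1 ≤ p)] : 0 < p :=
  zero_lt_one.trans_le Fact.out

theorem exponent_toReal_pos (hp : p ≠ ∞) : 0 < p.toReal :=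
  ENNReal.toReal_pos (exponent_pos p).ne' hp

section Map

variable [Nonempty ι] {X Y : ι → Type*} [∀ i, NormedAddCommGroup (X i)] [∀ i, NormedSpace ℝ (X i)]
  [∀ i, NormedAddCommGroup (Y i)] [∀ i, NormedSpace ℝ (Y i)]

/-- The operator between `ℓ^p` sums acting by `A i` in the coordinate `i`. -/
noncomputable def lpMap (A : ∀ i, X i →L[ℝ] Y i) (M : ℝ) (hA : ∀ i, ‖A i‖ ≤ M) :
    lp X p →L[ℝ] lp Y p :=
  LinearMap.mkContinuous
    { toFun z := ⟨fun i => A i (z i),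
        ((lp.memℓp z).norm.const_mul M).mono fun i => le_of_opNorm_le _ (hA i) _⟩
      map_add' z w := lp.ext (funext fun i => map_add (A i) (z i) (w i))
      map_smul' c z := lp.ext (funext fun i => map_smul (A i) c (z i)) } M fun z => by
    have hM : 0 ≤ M := (norm_nonneg _).trans (hA (Classical.arbitrary ι))
    calc _ ≤ ‖M • z‖ := lp.norm_mono (exponent_pos p).ne' fun i => by
            simpa [norm_smul, abs_of_nonneg hM] using le_of_opNorm_le _ (hA i) (z i)
      _ = M * ‖z‖ := by rw [norm_smul, Real.norm_of_nonneg hM]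

variable {A : ∀ i, X i →L[ℝ] Y i} {M : ℝ} (hA : ∀ i, ‖A i‖ ≤ M)

@[simp]
theorem lpMap_apply (z : lp X p) (i : ι) : lpMap A M hA z i = A i (z i) := rfl

theorem norm_lpMap_le : ‖(lpMap A M hA : lp X p →L[ℝ] lp Y p)‖ ≤ M :=
  LinearMap.mkContinuous_norm_le _ ((norm_nonneg _).trans (hA (Classical.arbitrary ι))) _

theorem lpMap_single [DecidableEq ι] (i : ι) (x : X i) :
    lpMap A M hA (lp.single p i x) = lp.single p i (A i x) :=
  lp.ext (funext fun j => by
    rw [lpMap_apply, lp.single_apply, lp.single_apply, Pi.apply_single (fun j => A j) (by simp)])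

end Map

section Reindex

variable {X : Type*} [NormedAddCommGroup X] {e : ι → κ}

theorem memℓp_comp (he : e.Injective) (z : lp (fun _ : κ => X) p) : Memℓp (fun i => z (e i)) p := by
  rcases eq_or_ne p ∞ with rfl | hp
  · refine memℓp_infty ⟨‖z‖, ?_⟩
    rintro _ ⟨i, rfl⟩
    exact lp.norm_apply_le_norm ENNReal.top_ne_zero z _
  · exact memℓp_gen (((lp.memℓp z).summable (exponent_toReal_pos hp)).comp_injective he)

theorem norm_extend_le (he : e.Injective) (z : lp (fun _ : ι => X) ∞) (k : κ) :
    ‖Function.extend e z 0 k‖ ≤ ‖z‖ := by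
  by_cases hk : ∃ i, e i = k
  · obtain ⟨i, rfl⟩ := hk
    rw [he.extend_apply]
    exact lp.norm_apply_le_norm ENNReal.top_ne_zero z i
  · simp [Function.extend_apply' _ _ _ hk]

theorem norm_extend_rpow (e : ι → κ) (z : ι → X) {r : ℝ} (hr : 0 < r) :
    (fun k => ‖Function.extend e z 0 k‖ ^ r) = Function.extend e (fun i => ‖z i‖ ^ r) 0 := by
  funext k
  rw [Function.apply_extend fun x : X => ‖x‖ ^ r]
  congr 1
  ext
  simp [hr.ne']

theorem memℓp_extend (he : e.Injective) (z : lp (fun _ : ι => X) p) :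
    Memℓp (Function.extend e z 0 : κ → X) p := by
  rcases eq_or_ne p ∞ with rfl | hp
  · refine memℓp_infty ⟨‖z‖, ?_⟩
    rintro _ ⟨k, rfl⟩
    exact norm_extend_le he z k
  · refine memℓp_gen ?_
    rw [norm_extend_rpow e z (exponent_toReal_pos hp), summable_extend_zero he]
    exact (lp.memℓp z).summable (exponent_toReal_pos hp)

variable [NormedSpace ℝ X]

/-- Restriction of `ℓ^p` families along an injective map of the index sets. -/
noncomputable def lpRestrict (e : ι → κ) (he : e.Injective) :
    lp (fun _ : κ => X) p →L[ℝ] lp (fun _ : ι => X) p :=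
  LinearMap.mkContinuous
    { toFun z := ⟨fun i => z (e i), memℓp_comp he z⟩
      map_add' _ _ := rfl
      map_smul' _ _ := rfl } 1 fun z => by
    rw [one_mul]
    rcases eq_or_ne p ∞ with rfl | hp
    · exact lp.norm_le_of_forall_le (norm_nonneg _)
        fun i => lp.norm_apply_le_norm ENNReal.top_ne_zero z _
    · have hp' := exponent_toReal_pos hp
      refine lp.norm_le_of_tsum_le hp' (norm_nonneg _) ?_
      rw [lp.norm_rpow_eq_tsum hp']
      exact tsum_comp_le_tsum_of_inj ((lp.memℓp z).summable hp') (fun _ => by positivity) he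

/-- Extension by zero of `ℓ^p` families along an injective map of the index sets. -/
noncomputable def lpExtend (e : ι → κ) (he : e.Injective) :
    lp (fun _ : ι => X) p →L[ℝ] lp (fun _ : κ => X) p :=
  LinearMap.mkContinuous
    { toFun z := ⟨Function.extend e z 0, memℓp_extend he z⟩
      map_add' z w := lp.ext
        ((congrArg (Function.extend e _) (add_zero _).symm).trans (Function.extend_add e z w 0 0))
      map_smul' c z := lp.ext
        ((congrArg (Function.extend e _) (smul_zero c).symm).trans
          (Function.extend_smul c e z 0)) } 1
    fun z => by
    rw [one_mul]
    rcases eq_or_ne p ∞ with rfl | hp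
    · exact lp.norm_le_of_forall_le (norm_nonneg _) (norm_extend_le he z)
    · have hp' := exponent_toReal_pos hp
      refine lp.norm_le_of_tsum_le hp' (norm_nonneg _) ?_
      rw [lp.norm_rpow_eq_tsum hp', ← tsum_extend_zero he]
      exact (congrArg tsum (norm_extend_rpow e z hp')).le

variable (he : e.Injective)

@[simp]
theorem lpRestrict_apply (z : lp (fun _ : κ => X) p) (i : ι) : lpRestrict e he z i = z (e i) := rfl

theorem norm_lpRestrict_le :
    ‖(lpRestrict e he : lp (fun _ : κ => X) p →L[ℝ] lp (fun _ : ι => X) p)‖ ≤ 1 :=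
  LinearMap.mkContinuous_norm_le _ zero_le_one _

@[simp]
theorem lpExtend_apply (z : lp (fun _ : ι => X) p) (i : ι) : lpExtend e he z (e i) = z i :=
  he.extend_apply _ _ _

theorem lpExtend_apply_of_notMem (z : lp (fun _ : ι => X) p) {k : κ} (hk : k ∉ Set.range e) :
    lpExtend e he z k = 0 :=
  Function.extend_apply' _ _ _ hk

theorem norm_lpExtend_le :
    ‖(lpExtend e he : lp (fun _ : ι => X) p →L[ℝ] lp (fun _ : κ => X) p)‖ ≤ 1 :=
  LinearMap.mkContinuous_norm_le _ zero_le_one _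

end Reindex

end SequenceSpaces

section AlmostDisjoint

theorem exists_almostDisjoint_family :
    ∃ s : (ℕ → Bool) → Set ℕ, (∀ f, (s f).Infinite) ∧ Pairwise fun f g => (s f ∩ s g).Finite := by
  let code (f : ℕ → Bool) (n : ℕ) : ℕ := Encodable.encode (List.ofFn fun i : Fin n => f i)
  have hcode {f g n m} (h : code f n = code g m) : n = m ∧ ∀ i < n, f i = g i := by
    have hlist := Encodable.encode_injective h
    obtain rfl : n = m := by simpa using congrArg List.length hlist
    exact ⟨rfl, fun i hi => congrFun (List.ofFn_injective hlist) ⟨i, hi⟩⟩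
  refine ⟨fun f => Set.range (code f),
    fun f => Set.infinite_range_of_injective fun n m h => (hcode h).1, fun f g hfg => ?_⟩
  obtain ⟨i, hi⟩ := Function.ne_iff.1 hfg
  refine ((Set.finite_Iic i).image (code f)).subset ?_
  rintro _ ⟨⟨n, rfl⟩, m, hm⟩
  exact ⟨n, not_lt.1 fun hin => hi ((hcode hm.symm).2 i hin), rfl⟩

end AlmostDisjoint

section Vanishing

variable {ι α : Type*} {X : ι → Type*} [∀ i, NormedAddCommGroup (X i)]
  [∀ i, NormedSpace ℝ (X i)] [DecidableEq ι] {φ : StrongDual ℝ (lp X ∞)} {s : α → Set ι}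

theorem norm_apply_le_of_eventually_norm_le (hφ : ∀ i x, φ (lp.single ∞ i x) = 0) {z : lp X ∞}
    {M : ℝ} (hM : 0 ≤ M) (hz : ∀ᶠ i in cofinite, ‖z i‖ ≤ M) : ‖φ z‖ ≤ ‖φ‖ * M := by
  set F : Finset ι := (eventually_cofinite.1 hz).toFinset with hF
  let v : lp X ∞ := z - ∑ i ∈ F, lp.single ∞ i (z i)
  have hφv : φ v = φ z := by simp [v, hφ]
  have hv : ‖v‖ ≤ M := lp.norm_le_of_forall_le hM fun i => by
    have hvi : v i = if i ∈ F then 0 else z i := by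
      simp only [v, lp.coeFn_sub, lp.coeFn_sum, lp.single_apply, Pi.sub_apply, Finset.sum_apply,
        Finset.sum_pi_single]
      split_ifs <;> simp
    rw [hvi]
    split_ifs with hi
    · simpa using hM
    · simpa [hF] using hi
  rw [← hφv]
  exact le_of_opNorm_le_of_le _ le_rfl hv

/-- Up to finitely many coordinates, which `φ` does not see, the `w a` are disjointly supported, so
their sum has norm at most `1`. -/
theorem sum_apply_le_norm_of_almostDisjoint (hφ : ∀ i x, φ (lp.single ∞ i x) = 0)
    (hs : Pairwise fun a a' => (s a ∩ s a').Finite) {w : α → lp X ∞} (hw : ∀ a, ‖w a‖ ≤ 1)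
    (hws : ∀ a, ∀ i ∉ s a, w a i = 0) (t : Finset α) : ∑ a ∈ t, φ (w a) ≤ ‖φ‖ := by
  have hdisj : ∀ᶠ i in cofinite, ∀ a ∈ t, ∀ a' ∈ t, a ≠ a' → i ∈ s a → i ∉ s a' := by
    simp only [eventually_all_finset, eventually_imp_distrib_left]
    intro a _ a' _ ha
    filter_upwards [(hs ha).compl_mem_cofinite] with i hi hia hia' using hi ⟨hia, hia'⟩
  have hsum : ∀ᶠ i in cofinite, ‖(∑ a ∈ t, w a) i‖ ≤ 1 := by
    filter_upwards [hdisj] with i hi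
    rw [lp.coeFn_sum, Finset.sum_apply]
    by_cases hex : ∃ a ∈ t, w a i ≠ 0
    · obtain ⟨a, ha, hai⟩ := hex
      have his : i ∈ s a := not_imp_comm.1 (hws a i) hai
      rw [Finset.sum_eq_single_of_mem a ha fun a' ha' hne =>
        hws a' i (hi a ha a' ha' hne.symm his)]
      exact (lp.norm_apply_le_norm ENNReal.top_ne_zero (w a) i).trans (hw a)
    · push Not at hex
      simp [Finset.sum_eq_zero hex]
  calc ∑ a ∈ t, φ (w a) = φ (∑ a ∈ t, w a) := (map_sum _ _ _).symm
    _ ≤ ‖φ‖ * 1 := (le_abs_self _).trans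
      (norm_apply_le_of_eventually_norm_le hφ zero_le_one hsum)
    _ = ‖φ‖ := mul_one _

theorem countable_setOf_exists_apply_ne_zero (hφ : ∀ i x, φ (lp.single ∞ i x) = 0)
    (hs : Pairwise fun a a' => (s a ∩ s a').Finite) :
    {a | ∃ z, (∀ i ∉ s a, z i = 0) ∧ φ z ≠ 0}.Countable := by
  set bad := {a | ∃ z, (∀ i ∉ s a, z i = 0) ∧ φ z ≠ 0}
  have hnormalized (a : bad) : ∃ w : lp X ∞, ‖w‖ ≤ 1 ∧ (∀ i ∉ s a, w i = 0) ∧ 0 < φ w := by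
    obtain ⟨z, hz, hφz⟩ := a.2
    have hz0 : 0 < ‖z‖ := norm_pos_iff.2 fun h => hφz (by rw [h, map_zero])
    refine ⟨(φ z / (|φ z| * ‖z‖)) • z, ?_, fun i hi => by simp [hz i hi], ?_⟩
    · rw [norm_smul, norm_div, norm_mul, norm_norm, Real.norm_eq_abs, Real.norm_eq_abs, abs_abs]
      field_simp
      rfl
    · rw [map_smul, smul_eq_mul, div_mul_eq_mul_div]
      have := mul_self_pos.2 hφz
      positivity
  choose w hw hws hpos using hnormalized
  have hsummable : Summable fun a : bad => φ (w a) :=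
    summable_of_sum_le (fun a => (hpos a).le)
      (sum_apply_le_norm_of_almostDisjoint hφ (hs.comp_of_injective Subtype.val_injective) hw hws)
  have huniv : Function.support (fun a : bad => φ (w a)) = Set.univ :=
    Set.eq_univ_of_forall fun a => (hpos a).ne'
  exact Set.countable_coe_iff.1 (Set.countable_univ_iff.1 (huniv ▸ hsummable.countable_support))

end Vanishing

section Rows

variable {p : ℝ≥0∞} [Fact (1 ≤ p)]

theorem exists_infinite_forall_supported_eq_zero {X : ℕ → Type*} [∀ i, NormedAddCommGroup (X i)]
    [∀ i, NormedSpace ℝ (X i)] {V κ : Type*} [NormedAddCommGroup V] [NormedSpace ℝ V] [Countable κ]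
    (ψ : κ → StrongDual ℝ V) (hψ : ∀ v, (∀ k, ψ k v = 0) → v = 0) (S : lp X p →L[ℝ] V)
    (hS : ∀ i x, S (lp.single p i x) = 0) :
    ∃ s : Set ℕ, s.Infinite ∧ ∀ z : lp X p, (∀ i ∉ s, z i = 0) → S z = 0 := by
  rcases eq_or_ne p ∞ with rfl | hp
  · obtain ⟨s, hinf, hs⟩ := exists_almostDisjoint_family
    have hcountable : (⋃ k, {f | ∃ z, (∀ i ∉ s f, z i = 0) ∧ (ψ k ∘L S) z ≠ 0}).Countable :=
      Set.countable_iUnion fun k =>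
        countable_setOf_exists_apply_ne_zero (fun i x => by simp [hS]) hs
    have : Uncountable (ℕ → Bool) := by
      simp [← Cardinal.aleph0_lt_mk_iff, Cardinal.aleph0_lt_continuum]
    obtain ⟨f, hf⟩ : ∃ f, ∀ k, ¬∃ z, (∀ i ∉ s f, z i = 0) ∧ (ψ k ∘L S) z ≠ 0 := by
      by_contra! h
      exact Set.not_countable_univ (hcountable.mono fun f _ => Set.mem_iUnion.2 (h f))
    exact ⟨s f, hinf f, fun z hz => hψ _ fun k => by_contra fun hk => hf k ⟨z, hz, hk⟩⟩
  · have hS0 : S = 0 := lp.ext_continuousLinearMap hp fun i => by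
      ext x
      simpa using hS i x
    exact ⟨Set.univ, Set.infinite_univ, fun z _ => by rw [hS0, zero_apply]⟩

variable {X : Type*} [NormedAddCommGroup X] [NormedSpace ℝ X]

/-- The diagonal entries of an operator on an `ℓ^p` sum, viewed as an operator matrix. -/
noncomputable def diagonalBlock (D : lp (fun _ : ℕ => X) p →L[ℝ] lp (fun _ : ℕ => X) p) (i : ℕ) :
    X →L[ℝ] X :=
  lp.evalCLM ℝ (fun _ => X) p i ∘L D ∘L lp.singleContinuousLinearMap ℝ (fun _ => X) p i

theorem diagonalBlock_apply (D : lp (fun _ : ℕ => X) p →L[ℝ] lp (fun _ : ℕ => X) p) (i : ℕ)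
    (x : X) : diagonalBlock D i x = D (lp.single p i x) i := rfl

theorem norm_diagonalBlock_le (D : lp (fun _ : ℕ => X) p →L[ℝ] lp (fun _ : ℕ => X) p) (i : ℕ) :
    ‖diagonalBlock D i‖ ≤ ‖D‖ :=
  opNorm_le_bound _ (norm_nonneg _) fun x => by
    calc ‖diagonalBlock D i x‖ ≤ ‖D (lp.single p i x)‖ :=
          lp.norm_apply_le_norm (exponent_pos p).ne' _ i
      _ ≤ ‖D‖ * ‖x‖ :=
        D.le_opNorm_of_le (lp.norm_single (E := fun _ => X) (exponent_pos p) i x).le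

theorem exists_infinite_forall_supported_apply_eq {κ : Type*} [Countable κ]
    (ψ : κ → StrongDual ℝ X) (hψ : ∀ x, (∀ k, ψ k x = 0) → x = 0)
    (D : lp (fun _ : ℕ => X) p →L[ℝ] lp (fun _ : ℕ => X) p)
    (hD : ∀ i k x, i ≠ k → D (lp.single p k x) i = 0) :
    ∃ s : Set ℕ, s.Infinite ∧ ∀ z : lp (fun _ : ℕ => X) p, (∀ i ∉ s, z i = 0) →
      ∀ i, D z i = diagonalBlock D i (z i) := by
  obtain ⟨s, hinf, hs⟩ := exists_infinite_forall_supported_eq_zero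
    (fun q : ℕ × κ => ψ q.2 ∘L lp.evalCLM ℝ (fun _ => X) p q.1)
    (fun z hz => lp.ext (funext fun i => hψ _ fun k => hz (i, k)))
    (D - lpMap (diagonalBlock D) ‖D‖ (norm_diagonalBlock_le D)) fun k x =>
      lp.ext (funext fun i => by
        rw [sub_apply, lpMap_single, lp.coeFn_sub, Pi.sub_apply, diagonalBlock_apply]
        rcases eq_or_ne i k with rfl | hik
        · rw [lp.single_apply_self, sub_self, lp.coeFn_zero, Pi.zero_apply]
        · rw [hD i k x hik, lp.single_apply_ne _ _ _ hik, sub_zero, lp.coeFn_zero, Pi.zero_apply])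
  refine ⟨s, hinf, fun z hz i => sub_eq_zero.1 ?_⟩
  exact congrArg (fun w : lp (fun _ : ℕ => X) p => w i) (hs z hz)

end Rows

section RowFactorization

variable {E : Type*} [NormedAddCommGroup E] [NormedSpace ℝ E] {p : ℝ≥0∞} [Fact (1 ≤ p)] {K : ℝ}

theorem FactorsThrough.exists_norm_le {T : E →L[ℝ] E} (h : FactorsThrough (.id ℝ E) T K) :
    ∃ R S : E →L[ℝ] E, ‖R‖ ≤ K ∧ ‖S‖ ≤ 1 ∧ ∀ x, R (T (S x)) = x := by
  obtain ⟨R, S, hRS, h⟩ := h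
  rcases eq_or_ne S 0 with rfl | hS
  · refine ⟨0, 0, by simpa using hRS, by simp, fun x => ?_⟩
    simpa using (congr($h x)).symm
  · have hS' : ‖S‖ ≠ 0 := norm_ne_zero_iff.2 hS
    refine ⟨‖S‖ • R, ‖S‖⁻¹ • S, ?_, ?_, fun x => ?_⟩
    · rwa [norm_smul, norm_norm, mul_comm]
    · rw [norm_smul, norm_inv, norm_norm, inv_mul_cancel₀ hS']
    · simpa [smul_smul, hS'] using (congr($h x)).symm

theorem factorsThrough_id_of_infinite_rows {D : lp (fun _ : ℕ => E) p →L[ℝ] lp (fun _ : ℕ => E) p}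
    {d : ℕ → E →L[ℝ] E} {s : Set ℕ} (hs : s.Infinite)
    (hd : ∀ i ∈ s, FactorsThrough (.id ℝ E) (d i) K)
    (hD : ∀ z : lp (fun _ : ℕ => E) p, (∀ i ∉ s, z i = 0) → ∀ i ∈ s, D z i = d i (z i)) :
    FactorsThrough (.id ℝ _) D K := by
  let e : ℕ ↪ s := hs.natEmbedding
  have he : (fun n => (e n : ℕ)).Injective := Subtype.val_injective.comp e.injective
  choose R S hR hS hRS using fun n => (hd (e n) (e n).2).exists_norm_le
  have hK : 0 ≤ K := (norm_nonneg _).trans (hR 0)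
  refine ⟨lpMap R K hR ∘L lpRestrict _ he, lpExtend _ he ∘L lpMap S 1 hS, ?_, ?_⟩
  · calc _ ≤ (K * 1) * (1 * 1) :=
          mul_le_mul
            ((opNorm_comp_le _ _).trans
              (mul_le_mul (norm_lpMap_le hR) (norm_lpRestrict_le he) (norm_nonneg _) hK))
            ((opNorm_comp_le _ _).trans
              (mul_le_mul (norm_lpExtend_le he) (norm_lpMap_le hS) (norm_nonneg _) zero_le_one))
            (norm_nonneg _) (by positivity)
      _ = K := by ring
  · ext z n : 3
    have hsupp i (hi : i ∉ s) : lpExtend _ he (lpMap S 1 hS z) i = 0 :=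
      lpExtend_apply_of_notMem he _ fun ⟨n, hn⟩ => hi (hn ▸ (e n).2)
    simp only [id_apply, comp_apply, lpMap_apply, lpRestrict_apply, hD _ hsupp _ (e n).2]
    rw [lpExtend_apply he, lpMap_apply, hRS]

theorem HasPrimaryDiagonalFactorization.factorsThrough_lp_or {b : SchauderBasis ℝ E} {C t : ℝ}
    (hdiag : HasPrimaryDiagonalFactorization b C) (ht : 0 < t)
    {D : lp (fun _ : ℕ => E) p →L[ℝ] lp (fun _ : ℕ => E) p}
    (hD : ∀ i j k l, (i, j) ≠ (k, l) → b.coord j (D (lp.single p k (b l)) i) = 0) :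
    FactorsThrough (.id ℝ _) D (C + t) ∨ FactorsThrough (.id ℝ _) (.id ℝ _ - D) (C + t) := by
  have hblock i k x (hik : i ≠ k) : D (lp.single p k x) i = 0 := by
    have hzero : lp.evalCLM ℝ (fun _ => E) p i ∘L D ∘L
        lp.singleContinuousLinearMap ℝ (fun _ => E) p k = 0 :=
      ext_of_forall_basis b fun l => eq_zero_of_forall_coord_eq_zero b fun j =>
        hD i j k l (by simp [hik])
    exact congr($hzero x)
  obtain ⟨s, hinf, hs⟩ := exists_infinite_forall_supported_apply_eq b.coord
    (fun _ hx => eq_zero_of_forall_coord_eq_zero b hx) D hblock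
  have hor i : FactorsThrough (.id ℝ E) (diagonalBlock D i) (C + t) ∨
      FactorsThrough (.id ℝ E) (.id ℝ E - diagonalBlock D i) (C + t) :=
    (hdiag (diagonalBlock D i) fun j l hjl => hD i j i l (by simp [hjl])).imp
      (fun h => h t ht) fun h => h t ht
  have hsplit : s = s ∩ {i | FactorsThrough (.id ℝ E) (diagonalBlock D i) (C + t)} ∪
      s ∩ {i | FactorsThrough (.id ℝ E) (.id ℝ E - diagonalBlock D i) (C + t)} := by
    rw [← Set.inter_union_distrib_left, eq_comm, Set.inter_eq_left]
    exact fun i _ => hor i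
  rw [hsplit, Set.infinite_union] at hinf
  refine hinf.imp
    (fun h => factorsThrough_id_of_infinite_rows h (fun i hi => hi.2) fun z hz i _ =>
      hs z (fun i hi => hz i (mt And.left hi)) i)
    fun h => factorsThrough_id_of_infinite_rows h (fun i hi => hi.2) fun z hz i _ => ?_
  rw [sub_apply, lp.coeFn_sub, Pi.sub_apply, hs z (fun i hi => hz i (mt And.left hi)) i]
  rfl

theorem IsStrategicallyReproducibleProj.hasPrimaryFactorization_lp [CompleteSpace E]
    {b : SchauderBasis ℝ E} {Cr C : ℝ} (hrep : IsStrategicallyReproducibleProj b Cr)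
    (hCr : 0 ≤ Cr) (hdiag : HasPrimaryDiagonalFactorization b C) :
    HasPrimaryFactorization (lp (fun _ : ℕ => E) p) (b.nnnormProjBound * Cr * C) := by
  refine .of_compression fun T t ht => ?_
  obtain ⟨A, B, α, β, hA, hB, hβα, hBA, hdiagonalize⟩ :=
    hrep.exists_diagonalizing_operators (ev := lp.evalCLM ℝ (fun _ : ℕ => E) p)
      (sg := lp.singleContinuousLinearMap ℝ (fun _ : ℕ => E) p) hCr
      (fun i k x => by
        change (lp.single p k x : lp (fun _ : ℕ => E) p) i = _
        rw [lp.single_apply, Pi.single_apply]) T ht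
  let A' : lp (fun _ : ℕ => E) p →L[ℝ] lp (fun _ : ℕ => E) p := lpMap A α hA
  let B' : lp (fun _ : ℕ => E) p →L[ℝ] lp (fun _ : ℕ => E) p := lpMap B β hB
  obtain ⟨X, hX, hdiagonal⟩ := hdiagonalize A' B' (fun k x => lpMap_single hA k x)
    fun i z => lpMap_apply hB z i
  refine ⟨A', B', B' ∘L T ∘L A' - X, ?_, ?_, ?_, hdiag.factorsThrough_lp_or ht hdiagonal⟩
  · ext z i : 3
    exact congr($(hBA i) (z i))
  · refine le_trans ?_ hβα
    exact mul_le_mul (norm_lpMap_le hB) (norm_lpMap_le hA) (norm_nonneg _)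
      ((norm_nonneg _).trans (hB 0))
  · rwa [sub_sub_cancel_left, norm_neg]

end RowFactorization

section Decomposition

variable {ι κ X Y : Type*} [NormedAddCommGroup X] [NormedAddCommGroup Y] {p : ℝ≥0∞}

theorem nontrivial_lp [Nonempty ι] [Nontrivial X] : Nontrivial (lp (fun _ : ι => X) p) := by
  classical
  obtain ⟨x, hx⟩ := exists_ne (0 : X)
  let i := Classical.arbitrary ι
  refine ⟨lp.single p i x, 0, fun h => hx ?_⟩
  simpa using congrArg (fun z : lp (fun _ : ι => X) p => z i) h

variable [Fact (1 ≤ p)]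

theorem memℓp_uncurry (w : lp (fun _ : ι => lp (fun _ : κ => X) p) p) :
    Memℓp (fun q : ι × κ => w q.1 q.2) p := by
  rcases eq_or_ne p ∞ with rfl | hp
  · refine memℓp_infty ⟨‖w‖, ?_⟩
    rintro _ ⟨q, rfl⟩
    exact (lp.norm_apply_le_norm ENNReal.top_ne_zero _ _).trans
      (lp.norm_apply_le_norm ENNReal.top_ne_zero w _)
  · have hp' := exponent_toReal_pos hp
    refine memℓp_gen ((summable_prod_of_nonneg fun _ => by positivity).2
      ⟨fun i => (lp.memℓp (w i)).summable hp', ?_⟩)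
    simpa only [lp.norm_rpow_eq_tsum hp'] using (lp.memℓp w).summable hp'

variable [NormedSpace ℝ X] [NormedSpace ℝ Y]

/-- The row `i` of an `ℓ^p` family indexed by a product. -/
noncomputable def lpRow (i : ι) : lp (fun _ : ι × κ => X) p →L[ℝ] lp (fun _ : κ => X) p :=
  lpRestrict (Prod.mk i) (Prod.mk_right_injective i)

theorem hasSum_norm_lpRow_rpow (hp : p ≠ ∞) (z : lp (fun _ : ι × κ => X) p) :
    HasSum (fun i => ‖lpRow i z‖ ^ p.toReal) (‖z‖ ^ p.toReal) :=
  (lp.hasSum_norm (exponent_toReal_pos hp) z).prod_fiberwise fun i =>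
    lp.hasSum_norm (exponent_toReal_pos hp) (lpRow i z)

theorem norm_lpRow_le (i : ι) (z : lp (fun _ : ι × κ => X) p) : ‖lpRow i z‖ ≤ ‖z‖ :=
  (le_of_opNorm_le _ (norm_lpRestrict_le _) z).trans_eq (one_mul _)

theorem memℓp_lpRow (z : lp (fun _ : ι × κ => X) p) : Memℓp (fun i => lpRow i z) p := by
  rcases eq_or_ne p ∞ with rfl | hp
  · refine memℓp_infty ⟨‖z‖, ?_⟩
    rintro _ ⟨i, rfl⟩
    exact norm_lpRow_le i z
  · exact memℓp_gen (hasSum_norm_lpRow_rpow hp z).summable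

theorem norm_eq_norm_lpRow (z : lp (fun _ : ι × κ => X) p) :
    ‖(⟨_, memℓp_lpRow z⟩ : lp (fun _ : ι => lp (fun _ : κ => X) p) p)‖ = ‖z‖ := by
  set w : lp (fun _ : ι => lp (fun _ : κ => X) p) p := ⟨_, memℓp_lpRow z⟩
  rcases eq_or_ne p ∞ with rfl | hp
  · refine le_antisymm (lp.norm_le_of_forall_le (norm_nonneg _) fun i => norm_lpRow_le i z)
      (lp.norm_le_of_forall_le (norm_nonneg _) fun q => ?_)
    exact (lp.norm_apply_le_norm ENNReal.top_ne_zero (w q.1) q.2).trans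
      (lp.norm_apply_le_norm ENNReal.top_ne_zero w q.1)
  · have hp' := exponent_toReal_pos hp
    refine (Real.rpow_left_inj (norm_nonneg _) (norm_nonneg _) hp'.ne').1 ?_
    exact (lp.hasSum_norm hp' w).unique (hasSum_norm_lpRow_rpow hp z)

/-- An `ℓ^p` sum over a product is an iterated `ℓ^p` sum. -/
noncomputable def lpCurry :
    lp (fun _ : ι × κ => X) p ≃ₗᵢ[ℝ] lp (fun _ : ι => lp (fun _ : κ => X) p) p where
  toFun z := ⟨_, memℓp_lpRow z⟩
  invFun w := ⟨_, memℓp_uncurry w⟩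
  map_add' _ _ := rfl
  map_smul' _ _ := rfl
  left_inv _ := rfl
  right_inv _ := rfl
  norm_map' := norm_eq_norm_lpRow

/-- `ℓ^p` sums over equinumerous index sets are isomorphic. -/
noncomputable def lpReindex (e : ι ≃ κ) :
    lp (fun _ : κ => X) p ≃L[ℝ] lp (fun _ : ι => X) p :=
  .equivOfInverse (lpRestrict e e.injective) (lpRestrict e.symm e.symm.injective)
    (fun z => lp.ext (funext fun k => congrArg z (e.apply_symm_apply k)))
    (fun z => lp.ext (funext fun i => congrArg z (e.symm_apply_apply i)))

/-- The `ℓ^p` sums of isomorphic spaces are isomorphic. -/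
noncomputable def lpCongr [Nonempty ι] (e : X ≃L[ℝ] Y) :
    lp (fun _ : ι => X) p ≃L[ℝ] lp (fun _ : ι => Y) p :=
  .equivOfInverse
    (lpMap (fun _ => (e : X →L[ℝ] Y)) _ fun _ => le_rfl)
    (lpMap (fun _ => (e.symm : Y →L[ℝ] X)) _ fun _ => le_rfl)
    (fun z => lp.ext (funext fun i => e.symm_apply_apply (z i)))
    (fun z => lp.ext (funext fun i => e.apply_symm_apply (z i)))

/-- The `ℓ^p` sum of a product is the product of the `ℓ^p` sums. -/
noncomputable def lpProd [Nonempty ι] :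
    lp (fun _ : ι => X × Y) p ≃L[ℝ] lp (fun _ : ι => X) p × lp (fun _ : ι => Y) p :=
  .equivOfInverse
    ((lpMap (fun _ => .fst ℝ X Y) _ fun _ => le_rfl).prod
      (lpMap (fun _ => .snd ℝ X Y) _ fun _ => le_rfl))
    ((lpMap (fun _ => .inl ℝ X Y) _ fun _ => le_rfl).coprod
      (lpMap (fun _ => .inr ℝ X Y) _ fun _ => le_rfl))
    (fun z => by ext i : 2; simp)
    (fun z => by ext i : 3 <;> simp)

/-- Splitting off the first summand of an `ℓ^p` sum. -/
noncomputable def lpSucc : lp (fun _ : ℕ => X) p ≃L[ℝ] X × lp (fun _ : ℕ => X) p :=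
  .equivOfInverse
    ((lp.evalCLM ℝ (fun _ : ℕ => X) p 0).prod (lpRestrict Nat.succ Nat.succ_injective))
    ((lp.singleContinuousLinearMap ℝ (fun _ : ℕ => X) p 0).coprod
      (lpExtend Nat.succ Nat.succ_injective))
    (fun z => by
      ext i : 2
      cases i with
      | zero => simp [lpExtend_apply_of_notMem, lp.evalCLM]
      | succ i => simp [lpExtend_apply Nat.succ_injective _ i])
    (fun z => by
      ext i : 3
      · simp [lpExtend_apply_of_notMem, lp.evalCLM]
      · simp [lpExtend_apply Nat.succ_injective _ i])

variable (X p) in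
/-- `ℓ^p(ℓ^p(X))` is isomorphic to `ℓ^p(X)`. -/
noncomputable def lpSquare :
    lp (fun _ : ℕ => X) p ≃L[ℝ] lp (fun _ : ℕ => lp (fun _ : ℕ => X) p) p :=
  (lpReindex Nat.pairEquiv).trans lpCurry.toContinuousLinearEquiv

/-- Pełczyński's decomposition method: `F ≃ Z × F` and `F × Z ≃ Z`. -/
theorem nonempty_equiv_of_complemented {Z F G H : Type*} [NormedAddCommGroup Z] [NormedSpace ℝ Z]
    [NormedAddCommGroup F] [NormedSpace ℝ F] [NormedAddCommGroup G] [NormedSpace ℝ G]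
    [NormedAddCommGroup H] [NormedSpace ℝ H] (hZ : Z ≃L[ℝ] lp (fun _ : ℕ => Z) p)
    (hZF : Z ≃L[ℝ] F × G) (hFZ : F ≃L[ℝ] Z × H) : Nonempty (F ≃L[ℝ] Z) := by
  let square : Z ≃L[ℝ] Z × Z :=
    hZ.trans (lpSucc.trans ((ContinuousLinearEquiv.refl ℝ Z).prodCongr hZ.symm))
  let rows : Z ≃L[ℝ] lp (fun _ : ℕ => F) p × lp (fun _ : ℕ => G) p :=
    hZ.trans ((lpCongr hZF).trans lpProd)
  let absorbF : Z ≃L[ℝ] F × Z :=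
    rows.trans ((lpSucc.prodCongr (.refl ℝ _)).trans
      ((ContinuousLinearEquiv.prodAssoc ℝ _ _ _).trans
        ((ContinuousLinearEquiv.refl ℝ F).prodCongr rows.symm)))
  let absorbZ : F ≃L[ℝ] Z × F :=
    hFZ.trans ((square.prodCongr (.refl ℝ H)).trans
      ((ContinuousLinearEquiv.prodAssoc ℝ _ _ _).trans
        ((ContinuousLinearEquiv.refl ℝ Z).prodCongr hFZ.symm)))
  exact ⟨absorbZ.trans ((ContinuousLinearEquiv.prodComm ℝ Z F).trans absorbF.symm)⟩

theorem nonempty_equiv_of_factorsThrough_projection {Z : Type*} [NormedAddCommGroup Z]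
    [NormedSpace ℝ Z] (hZ : Z ≃L[ℝ] lp (fun _ : ℕ => Z) p) {F G : Submodule ℝ Z}
    (hFG : F.IsTopCompl G) {P : Z →L[ℝ] F} {K : ℝ}
    (h : FactorsThrough (.id ℝ Z) (F.subtypeL ∘L P) K) : Nonempty (F ≃L[ℝ] Z) := by
  obtain ⟨A, B, -, hAB⟩ := h
  exact nonempty_equiv_of_complemented hZ (F.prodEquivOfIsTopCompl G hFG).symm
    (.equivOfRightInverse (A ∘L F.subtypeL) (P ∘L B) fun z => (congr($hAB z)).symm)

theorem HasPrimaryFactorization.isPrimarySpace {Z : Type*} [NormedAddCommGroup Z]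
    [NormedSpace ℝ Z] [CompleteSpace Z] {K : ℝ} (h : HasPrimaryFactorization Z K)
    (hZ : Z ≃L[ℝ] lp (fun _ : ℕ => Z) p) : IsPrimarySpace Z := by
  intro F G hF hG hcompl
  have hFG : F.IsTopCompl G := Submodule.IsCompl.isTopCompl_of_isClosed hcompl hF hG
  let e : Z ≃L[ℝ] F × G := (F.prodEquivOfIsTopCompl G hFG).symm
  let P : Z →L[ℝ] F := .fst ℝ F G ∘L e
  let Q : Z →L[ℝ] G := .snd ℝ F G ∘L e
  have hPQ : .id ℝ Z - F.subtypeL ∘L P = G.subtypeL ∘L Q := by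
    ext z
    exact sub_eq_of_eq_add' ((F.prodEquivOfIsTopCompl G hFG).apply_symm_apply z).symm
  refine (h (F.subtypeL ∘L P)).imp
    (fun h => nonempty_equiv_of_factorsThrough_projection hZ hFG (h 1 one_pos)) fun h => ?_
  rw [hPQ] at h
  exact nonempty_equiv_of_factorsThrough_projection hZ hFG.symm (h 1 one_pos)

end Decomposition

end StratRep

theorem theorem11p1_general {E : Type*} [NormedAddCommGroup E] [NormedSpace ℝ E] [CompleteSpace E]
    (b : SchauderBasis ℝ E) {Cr C : ℝ} (hCr : 0 ≤ Cr) (hrep : IsStrategicallyReproducibleProj b Cr)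
    (hdiag : HasPrimaryDiagonalFactorization b C) :
    (HasPrimaryFactorization E (b.nnnormProjBound * Cr * C) ∧
      NonFactorSetIsUniqueMaximalIdeal E) ∧
    ∀ (p : ℝ≥0∞) [Fact (1 ≤ p)],
      HasPrimaryFactorization (lp (fun _ : ℕ => E) p) (b.nnnormProjBound * Cr * C) ∧
      NonFactorSetIsUniqueMaximalIdeal (lp (fun _ : ℕ => E) p) ∧
      IsPrimarySpace (lp (fun _ : ℕ => E) p) := by
  have : Nontrivial E := ⟨b 0, 0, fun h => by simpa [h] using coord_apply_basis b 0 0⟩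
  have hE := hrep.hasPrimaryFactorization hCr hdiag
  refine ⟨⟨hE, hE.nonFactorSetIsUniqueMaximalIdeal⟩, fun p _ => ?_⟩
  have : Nontrivial (lp (fun _ : ℕ => E) p) := nontrivial_lp
  have hlp := hrep.hasPrimaryFactorization_lp (p := p) hCr hdiag
  exact ⟨hlp, hlp.nonFactorSetIsUniqueMaximalIdeal, hlp.isPrimarySpace (lpSquare E p)⟩

theorem theorem11p1 {E : Type*} [NormedAddCommGroup E] [NormedSpace ℝ E] [CompleteSpace E]
    (b : SchauderBasis ℝ E) (hnorm : ∀ j, ‖b j‖ = 1)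
    (lam : ℝ) (hlam : (b.nnnormProjBound : ℝ) = lam)
    (Cr C : ℝ) (hCr : 1 ≤ Cr) (hC : 1 ≤ C)
    (hrep : IsStrategicallyReproducibleProj b Cr)
    (hdiag : HasPrimaryDiagonalFactorization b C) :
    (HasPrimaryFactorization E (lam * Cr * C) ∧
      NonFactorSetIsUniqueMaximalIdeal E) ∧
    (∀ (p : ℝ≥0∞) [Fact (1 ≤ p)], p ≠ ∞ →
      HasPrimaryFactorization (lp (fun _ : ℕ => E) p) (lam * Cr * C) ∧
      NonFactorSetIsUniqueMaximalIdeal (lp (fun _ : ℕ => E) p) ∧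
      IsPrimarySpace (lp (fun _ : ℕ => E) p)) ∧
    (IsAsymptoticallyCurved b →
      HasPrimaryFactorization (lp (fun _ : ℕ => E) ∞) (lam * Cr * C) ∧
      NonFactorSetIsUniqueMaximalIdeal (lp (fun _ : ℕ => E) ∞) ∧
      IsPrimarySpace (lp (fun _ : ℕ => E) ∞)) := by
  subst hlam
  obtain ⟨hE, hlp⟩ := theorem11p1_general b (zero_le_one.trans hCr) hrep hdiag
  exact ⟨hE, fun p _ _ => hlp p, fun _ => hlp ∞⟩
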